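/- **Conventions.** All structures are finite with non-empty universe. For $n\ge 0$ let $\mathcal C=\mathcal C_n$ be the vocabulary consisting of a binary relation symbol $s$ and unary relation symbols $U_0,\dots,U_{n-1}$. $\mathrm{MSO}(\mathcal C)$ is first order logic over $\mathcal C$ extended by quantifiers over subsets of the universe and over subsets of the relation $s$; the quantifier rank $\mathrm{qr}$ is the maximal nesting depth of quantifiers of all kinds. $C^2$ is the two-variable fragment of first order logic (with equality) extended by the counting quantifiers $\exists^{\ge k},\exists^{\le k},\exists^{=k}$. "$s$ is a binary tree" means that $s$ is an acyclic directed graph in which exactly one vertex (the root) has in-degree $0$, all others have in-degree $1$, and all out-degrees are at most $2$; for a vertex $u$ of such a structure $\mathfrak T$, $\mathfrak T_u$ is the substructure on $u$ and its descendants. "Computable" means computable by a recursive function on Gödel numbers. A *Hintikka set* of rank $q$ for $\mathcal C$ is a finite set $\mathcal H$ (given as a repetition-free list) of $\mathrm{MSO}(\mathcal C)$-sentences of quantifier rank at most $q$ such that every $\mathcal C$-structure satisfies exactly one member of $\mathcal H$, and every $\mathrm{MSO}(\mathcal C)$-sentence of quantifier rank at most $q$ is equivalent to a disjunction of members of $\mathcal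 H$. (Members without a model are permitted.) Let $\mathrm{hin}(\mathcal C,\mathcal H)$ be $\mathcal C$ together with new unary symbols $C_\epsilon$, $\epsilon\in\mathcal H$. Write $\mathrm{rt}(x)=\forall y\,\neg s(y,x)$ and, for an $\mathrm{MSO}(\mathcal C)$-sentence $\omega$, $$\omega_{\mathrm{hin}}=\forall x\Big(\mathrm{rt}(x)\to\bigvee_{\epsilon\in\mathcal H,\ \epsilon\models\omega}C_\epsilon(x)\Big).$$ **Lemma.** There are a map $(n,q)\mapsto\mathcal H_{n,q}$, where $\mathcal H_{n,q}$ is a Hintikka set of rank $q$ for $\mathcal C_n$; a map $(n,q,\mathcal H)\mapsto\Theta_{n,q,\mathcal H}$ defined for all finite lists $\mathcal H$ of $\mathrm{MSO}(\mathcal C_n)$-formulas, with values in $C^2(\mathrm{hin}(\mathcal C_n,\mathcal H))$; and a map $(n,\alpha)\mapsto\gamma_\alpha$ from $\mathrm{MSO}(\mathcal C_n)$-formulas to $C^2(\mathcal D)$-formulas, where $\mathcal D=\mathrm{hin}(\mathcal C_n,\mathcal H_{n,\mathrm{qr}(\alpha)})$, such that all three maps are total and computable and the following holds. 1. Let $\mathcal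 H$ be any Hintikka set of rank $q$ for $\mathcal C_n$. Then $\Theta=\Theta_{n,q,\mathcal H}$ is a sentence, every $\omega_{\mathrm{hin}}$ is a $C^2$-sentence, and for every $\mathcal C_n$-structure $\mathfrak T_0$ in which $s$ is a binary tree: (i) there is exactly one expansion $\mathfrak T_1$ of $\mathfrak T_0$ to $\mathrm{hin}(\mathcal C_n,\mathcal H)$ with $\mathfrak T_1\models\Theta$, and in it $u\in C_\epsilon^{\mathfrak T_1}$ iff $(\mathfrak T_0)_u\models\epsilon$, for all vertices $u$ and all $\epsilon\in\mathcal H$; (ii) for every expansion $\mathfrak T_1\models\Theta$ of $\mathfrak T_0$ and every $\mathrm{MSO}(\mathcal C_n)$-sentence $\omega$ with $\mathrm{qr}(\omega)\le q$: $\mathfrak T_0\models\omega$ iff $\mathfrak T_1\models\omega_{\mathrm{hin}}$. 2. Let $\alpha$ be an $\mathrm{MSO}(\mathcal C_n)$-sentence. Then $\gamma_\alpha$ is a sentence, and for every $\mathcal C_n$-structure $\mathfrak M$ in which $s$ is a binary tree, $\mathfrak M\models\alpha$ iff some expansion $\mathfrak N$ of $\mathfrak M$ to $\mathcal D$ satisfies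 $\gamma_\alpha$. Moreover every expansion of $\mathfrak M$ to $\mathcal D$ that satisfies $\gamma_\alpha$ satisfies $\Theta_{n,q,\mathcal H_{n,q}}$ with $q=\mathrm{qr}(\alpha)$, so it is the unique expansion of item 1(i). -/

import Mathlib

/-- A structure with universe `A` over the vocabulary consisting of one binary relation symbol `s`
and the `n` unary relation symbols `U_0, …, U_{n-1}`. -/
structure Str (n : ℕ) (A : Type) where
  s : A → A → Prop
  U : Fin n → A → Prop

/-- `(A, s)` is a directed binary tree: acyclic, exactly one vertex (the root) has in-degree `0`, every
other vertex has in-degree `1`, and every vertex has out-degree at most `2`.  Edges point from a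
vertex to its children. -/
def IsBinaryTree {A : Type} (s : A → A → Prop) : Prop :=
  (∀ x, ¬ Relation.TransGen s x x) ∧
  (∃ r, (∀ y, ¬ s y r) ∧ ∀ x, x ≠ r → ∃! y, s y x) ∧
  ∀ x, {y | s x y}.encard ≤ 2

/-- The subtree rooted at `u`: the substructure generated by `u` and its descendants. -/
def Str.subtree {n : ℕ} {A : Type} (M : Str n A) (u : A) :
    Str n {v : A // Relation.ReflTransGen M.s u v} where
  s := fun v w => M.s v w
  U := fun i v => M.U i v

/-- `N` is an expansion of `M` by `m` further unary relations.  The symbols `U_0, …, U_{n-1}` of `M`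
keep their indices; the new symbols are `U_n, …, U_{n+m-1}`. -/
def Str.IsExpansion {n m : ℕ} {A : Type} (M : Str n A) (N : Str (n + m) A) : Prop :=
  N.s = M.s ∧ ∀ i : Fin n, N.U (Fin.castAdd m i) = M.U i

/-! ### Monadic second order logic -/

/-- MSO formulas over the vocabulary `s, U_0, …, U_{n-1}`.  There are three sorts of variables, each
indexed by `ℕ`: element variables `x`, set variables `X` (subsets of the universe) and relation
variables `R` (subsets of the relation `s`). -/
inductive MSO (n : ℕ) : Type
  | bot : MSO n
  | eq (x y : ℕ) : MSO n
  | un (i : Fin n) (x : ℕ) : MSO n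
  | edge (x y : ℕ) : MSO n
  | mem (X x : ℕ) : MSO n
  | rel (R x y : ℕ) : MSO n
  | neg (φ : MSO n) : MSO n
  | and (φ ψ : MSO n) : MSO n
  | or (φ ψ : MSO n) : MSO n
  | exElt (x : ℕ) (φ : MSO n) : MSO n
  | allElt (x : ℕ) (φ : MSO n) : MSO n
  | exSet (X : ℕ) (φ : MSO n) : MSO n
  | allSet (X : ℕ) (φ : MSO n) : MSO n
  | exRel (R : ℕ) (φ : MSO n) : MSO n
  | allRel (R : ℕ) (φ : MSO n) : MSO n

namespace MSO

/-- Satisfaction in `M` under assignments `e`, `S`, `T` of the element, set and relation variables. -/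
def Sat {n : ℕ} {A : Type} (M : Str n A) :
    MSO n → (ℕ → A) → (ℕ → A → Prop) → (ℕ → A → A → Prop) → Prop
  | bot, _, _, _ => False
  | eq x y, e, _, _ => e x = e y
  | un i x, e, _, _ => M.U i (e x)
  | edge x y, e, _, _ => M.s (e x) (e y)
  | mem X x, e, S, _ => S X (e x)
  | rel R x y, e, _, T => T R (e x) (e y)
  | neg φ, e, S, T => ¬ φ.Sat M e S T
  | and φ ψ, e, S, T => φ.Sat M e S T ∧ ψ.Sat M e S T
  | or φ ψ, e, S, T => φ.Sat M e S T ∨ ψ.Sat M e S T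
  | exElt x φ, e, S, T => ∃ a : A, φ.Sat M (Function.update e x a) S T
  | allElt x φ, e, S, T => ∀ a : A, φ.Sat M (Function.update e x a) S T
  | exSet X φ, e, S, T => ∃ P : A → Prop, φ.Sat M e (Function.update S X P) T
  | allSet X φ, e, S, T => ∀ P : A → Prop, φ.Sat M e (Function.update S X P) T
  | exRel R φ, e, S, T => ∃ Q : A → A → Prop, (∀ a b, Q a b → M.s a b) ∧
      φ.Sat M e S (Function.update T R Q)
  | allRel R φ, e, S, T => ∀ Q : A → A → Prop, (∀ a b, Q a b → M.s a b) →
      φ.Sat M e S (Function.update T R Q)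

/-- All free element, set and relation variables belong to `E`, `S`, `T` respectively. -/
def FreeIn {n : ℕ} : MSO n → Finset ℕ → Finset ℕ → Finset ℕ → Prop
  | bot, _, _, _ => True
  | eq x y, E, _, _ => x ∈ E ∧ y ∈ E
  | un _ x, E, _, _ => x ∈ E
  | edge x y, E, _, _ => x ∈ E ∧ y ∈ E
  | mem X x, E, S, _ => X ∈ S ∧ x ∈ E
  | rel R x y, E, _, T => R ∈ T ∧ x ∈ E ∧ y ∈ E
  | neg φ, E, S, T => φ.FreeIn E S T
  | and φ ψ, E, S, T => φ.FreeIn E S T ∧ ψ.FreeIn E S T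
  | or φ ψ, E, S, T => φ.FreeIn E S T ∧ ψ.FreeIn E S T
  | exElt x φ, E, S, T => φ.FreeIn (insert x E) S T
  | allElt x φ, E, S, T => φ.FreeIn (insert x E) S T
  | exSet X φ, E, S, T => φ.FreeIn E (insert X S) T
  | allSet X φ, E, S, T => φ.FreeIn E (insert X S) T
  | exRel R φ, E, S, T => φ.FreeIn E S (insert R T)
  | allRel R φ, E, S, T => φ.FreeIn E S (insert R T)

def IsSentence {n : ℕ} (φ : MSO n) : Prop := φ.FreeIn ∅ ∅ ∅

/-- Quantifier rank: the maximal depth of nested quantifiers (of all sorts). -/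
def qr {n : ℕ} : MSO n → ℕ
  | bot | eq _ _ | un _ _ | edge _ _ | mem _ _ | rel _ _ _ => 0
  | neg φ => φ.qr
  | and φ ψ | or φ ψ => max φ.qr ψ.qr
  | exElt _ φ | allElt _ φ | exSet _ φ | allSet _ φ | exRel _ φ | allRel _ φ => φ.qr + 1

/-- Gödel number of a formula. -/
def code {n : ℕ} : MSO n → ℕ
  | bot => Nat.pair 0 0
  | eq x y => Nat.pair 1 (Nat.pair x y)
  | un i x => Nat.pair 2 (Nat.pair i x)
  | edge x y => Nat.pair 3 (Nat.pair x y)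
  | mem X x => Nat.pair 4 (Nat.pair X x)
  | rel R x y => Nat.pair 5 (Nat.pair R (Nat.pair x y))
  | neg φ => Nat.pair 6 φ.code
  | and φ ψ => Nat.pair 7 (Nat.pair φ.code ψ.code)
  | or φ ψ => Nat.pair 8 (Nat.pair φ.code ψ.code)
  | exElt x φ => Nat.pair 9 (Nat.pair x φ.code)
  | allElt x φ => Nat.pair 10 (Nat.pair x φ.code)
  | exSet X φ => Nat.pair 11 (Nat.pair X φ.code)
  | allSet X φ => Nat.pair 12 (Nat.pair X φ.code)
  | exRel R φ => Nat.pair 13 (Nat.pair R φ.code)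
  | allRel R φ => Nat.pair 14 (Nat.pair R φ.code)

theorem code_injective {n : ℕ} : Function.Injective (code (n := n)) := by
  intro φ
  induction φ <;> intro ψ h <;> cases ψ <;>
    simp_all [code, Nat.pair_eq_pair, Fin.ext_iff] <;> grind

end MSO

/-- `M ⊨ φ`, for an MSO sentence `φ` and a structure with non-empty universe (the truth value then
does not depend on the assignments). -/
def Str.Models {n : ℕ} {A : Type} (M : Str n A) (φ : MSO n) : Prop :=
  ∀ e S T, φ.Sat M e S T

/-- `φ ⊨ ψ`: every (finite, non-empty) structure that satisfies `φ` satisfies `ψ`. -/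
def MSO.Entails {n : ℕ} (φ ψ : MSO n) : Prop :=
  ∀ (A : Type) [Finite A] [Nonempty A] (M : Str n A), M.Models φ → M.Models ψ

/-! ### The two-variable fragment with counting -/

/-- `C²` formulas over the vocabulary `s, U_0, …, U_{n-1}`, with the two variables
`x = false` and `y = true`.  The last three constructors are `∃^{≥k}`, `∃^{≤k}` and `∃^{=k}`. -/
inductive C2 (n : ℕ) : Type
  | bot : C2 n
  | eq (x y : Bool) : C2 n
  | un (i : Fin n) (x : Bool) : C2 n
  | edge (x y : Bool) : C2 n
  | neg (φ : C2 n) : C2 n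
  | and (φ ψ : C2 n) : C2 n
  | or (φ ψ : C2 n) : C2 n
  | ex (x : Bool) (φ : C2 n) : C2 n
  | all (x : Bool) (φ : C2 n) : C2 n
  | exGe (k : ℕ) (x : Bool) (φ : C2 n) : C2 n
  | exLe (k : ℕ) (x : Bool) (φ : C2 n) : C2 n
  | exEq (k : ℕ) (x : Bool) (φ : C2 n) : C2 n

namespace C2

def Sat {n : ℕ} {A : Type} (M : Str n A) : C2 n → (Bool → A) → Prop
  | bot, _ => False
  | eq x y, e => e x = e y
  | un i x, e => M.U i (e x)
  | edge x y, e => M.s (e x) (e y)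
  | neg φ, e => ¬ φ.Sat M e
  | and φ ψ, e => φ.Sat M e ∧ ψ.Sat M e
  | or φ ψ, e => φ.Sat M e ∨ ψ.Sat M e
  | ex x φ, e => ∃ a : A, φ.Sat M (Function.update e x a)
  | all x φ, e => ∀ a : A, φ.Sat M (Function.update e x a)
  | exGe k x φ, e => (k : ℕ∞) ≤ {a : A | φ.Sat M (Function.update e x a)}.encard
  | exLe k x φ, e => {a : A | φ.Sat M (Function.update e x a)}.encard ≤ (k : ℕ∞)
  | exEq k x φ, e => {a : A | φ.Sat M (Function.update e x a)}.encard = (k : ℕ∞)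

/-- All free variables belong to `E`. -/
def FreeIn {n : ℕ} : C2 n → Finset Bool → Prop
  | bot, _ => True
  | eq x y, E => x ∈ E ∧ y ∈ E
  | un _ x, E => x ∈ E
  | edge x y, E => x ∈ E ∧ y ∈ E
  | neg φ, E => φ.FreeIn E
  | and φ ψ, E => φ.FreeIn E ∧ ψ.FreeIn E
  | or φ ψ, E => φ.FreeIn E ∧ ψ.FreeIn E
  | ex x φ, E => φ.FreeIn (insert x E)
  | all x φ, E => φ.FreeIn (insert x E)
  | exGe _ x φ, E => φ.FreeIn (insert x E)
  | exLe _ x φ, E => φ.FreeIn (insert x E)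
  | exEq _ x φ, E => φ.FreeIn (insert x E)

def IsSentence {n : ℕ} (φ : C2 n) : Prop := φ.FreeIn ∅

/-- Gödel number of a formula. -/
def code {n : ℕ} : C2 n → ℕ
  | bot => Nat.pair 0 0
  | eq x y => Nat.pair 1 (Nat.pair x.toNat y.toNat)
  | un i x => Nat.pair 2 (Nat.pair i x.toNat)
  | edge x y => Nat.pair 3 (Nat.pair x.toNat y.toNat)
  | neg φ => Nat.pair 4 φ.code
  | and φ ψ => Nat.pair 5 (Nat.pair φ.code ψ.code)
  | or φ ψ => Nat.pair 6 (Nat.pair φ.code ψ.code)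
  | ex x φ => Nat.pair 7 (Nat.pair x.toNat φ.code)
  | all x φ => Nat.pair 8 (Nat.pair x.toNat φ.code)
  | exGe k x φ => Nat.pair 9 (Nat.pair k (Nat.pair x.toNat φ.code))
  | exLe k x φ => Nat.pair 10 (Nat.pair k (Nat.pair x.toNat φ.code))
  | exEq k x φ => Nat.pair 11 (Nat.pair k (Nat.pair x.toNat φ.code))

theorem code_injective {n : ℕ} : Function.Injective (code (n := n)) := by
  have hb : ∀ x y : Bool, x.toNat = y.toNat ↔ x = y := by decide
  intro φ
  induction φ <;> intro ψ h <;> cases ψ <;>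
    simp only [code, Nat.pair_eq_pair, hb] at h <;> grind

end C2

/-- `M ⊨ φ`, for a `C²` sentence `φ` and a structure with non-empty universe. -/
def Str.ModelsC2 {n : ℕ} {A : Type} (M : Str n A) (φ : C2 n) : Prop :=
  ∀ e, φ.Sat M e

/-! ### Hintikka sentences -/

/-- `H` lists a set of Hintikka sentences of rank `q` for the vocabulary `s, U_0, …, U_{n-1}`:
finitely many distinct MSO sentences of quantifier rank at most `q` such that every finite
structure satisfies exactly one of them (in particular, two distinct ones are never satisfied
together), and every MSO sentence of quantifier rank at most `q` is equivalent to a disjunction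
of some of them.  Members without a model are allowed. -/
structure IsHintikkaSet {n : ℕ} (q : ℕ) (H : List (MSO n)) : Prop where
  nodup : H.Nodup
  sentence : ∀ ε ∈ H, ε.IsSentence ∧ ε.qr ≤ q
  existsUnique : ∀ (A : Type) [Finite A] [Nonempty A] (M : Str n A),
    ∃! ε, ε ∈ H ∧ M.Models ε
  disjunction : ∀ ω : MSO n, ω.IsSentence → ω.qr ≤ q →
    ∃ S : Set (MSO n), (∀ ε ∈ S, ε ∈ H) ∧
      ∀ (A : Type) [Finite A] [Nonempty A] (M : Str n A),
        M.Models ω ↔ ∃ ε ∈ S, M.Models ε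

/-- The symbol `C_ε` of `hin(C, q)`, for `ε` the `i`-th member of `H`: it is the `i`-th of the new
unary symbols. -/
def hinSymbol {n : ℕ} (H : List (MSO n)) (i : Fin H.length) : Fin (n + H.length) :=
  Fin.natAdd n i

/-- The formula `rt(x) = ∀ y ¬ s(y, x)`. -/
def C2.rt (n : ℕ) : C2 n := .all true (.neg (.edge true false))

open Classical in
/-- The sentence `ω_hin = ∀ x (rt(x) → ⋁ {C_ε(x) | ε ∈ H, ε ⊨ ω})`. -/
noncomputable def omegaHin {n : ℕ} (H : List (MSO n)) (ω : MSO n) : C2 (n + H.length) :=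
  .all false (.or (.neg (C2.rt _))
    (((List.finRange H.length).filter fun i => (H.get i).Entails ω).foldr
      (fun i ψ => .or (.un (hinSymbol H i) false) ψ) .bot))

/-! The rank-`q` type of a tree depends only on the labels of its root and on the multiset of
rank-`q` types of the subtrees at the children of the root. Colouring every vertex by the type of
its subtree is therefore governed by a local condition between a vertex and its children, and `C²`
can express that condition by counting the children of each colour (`C2.theta`). Going up from the
leaves, the condition forces every colour, and the true types satisfy it
(`IsHintikkaSet.modelsC2_theta_iff`). The truth of a sentence of rank at most `q` in the whole tree
can then be read off the colour of the root.

Locality is a composition theorem for games. A position in the game on a tree is split into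
positions on the subtrees below the root, and the component strategies are played side by side
(`IsJoin.equivRank`). The delicate point is the edges from the fresh root: once that root has been
played, the strategy must tell whether a component element is the root of its component, which costs
one more round. That round is available because playing the fresh root uses up no round in the
components. The formulas `MSO.hin` describe game positions, and through them every Hintikka set,
however given, determines game equivalence (`IsHintikkaSet.equivRank`).

Effectiveness needs a further idea, since satisfiability of and entailment from Hintikka sentences
over all finite structures cannot be decided. Only types of trees matter here. The set of types
realized by trees of height less than `k` grows with `k`, and once it stands still for one step it
does so forever, so `k = |H|` suffices (`IsHintikkaSet.realized_length`). A bounded search with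
model checking thus finds a representative tree `rep` for each type with a tree model. Both the
colour of a vertex, given its labels and its children's colours, and the truth value of `α`, given
the colour of the root, are computed by model checking on trees assembled from representatives.
Because the type of formulas varies with `n`, all these computations are carried out on Gödel
numbers, where they are primitive recursive. -/

/-! ### Back-and-forth equivalence -/

section BackAndForth

variable {n : ℕ} {A B : Type}

/-- The correspondences `E`, `S`, `T` between elements, sets and relations preserve atomic formulas. -/
structure AtomicAgree (M : Str n A) (N : Str n B) (E : A → B → Prop)
    (S : (A → Prop) → (B → Prop) → Prop) (T : (A → A → Prop) → (B → B → Prop) → Prop) : Prop where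
  eq : ∀ {x y x' y'}, E x y → E x' y' → (x = x' ↔ y = y')
  un : ∀ {x y}, E x y → ∀ i, M.U i x ↔ N.U i y
  edge : ∀ {x y x' y'}, E x y → E x' y' → (M.s x x' ↔ N.s y y')
  mem : ∀ {P P' x y}, S P P' → E x y → (P x ↔ P' y)
  rel : ∀ {Q Q' x y x' y'}, T Q Q' → E x y → E x' y' → (Q x x' ↔ Q' y y')

/-- The correspondence `R` extended by the pair `(a, b)`. -/
def insertPair {α β : Type} (R : α → β → Prop) (a : α) (b : β) : α → β → Prop :=
  fun x y => R x y ∨ (x = a ∧ y = b)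

/-- The relation `Q` is a subset of the edge relation of `M`. -/
def Str.SubEdge (M : Str n A) (Q : A → A → Prop) : Prop := ∀ a b, Q a b → M.s a b

/-- Back-and-forth equivalence of rank `q` for monadic second order logic with element, set and
edge set moves. -/
def BF (M : Str n A) (N : Str n B) : ℕ → (A → B → Prop) →
    ((A → Prop) → (B → Prop) → Prop) → ((A → A → Prop) → (B → B → Prop) → Prop) → Prop
  | 0, E, S, T => AtomicAgree M N E S T
  | q + 1, E, S, T => AtomicAgree M N E S T ∧
      ((∀ a, ∃ b, BF M N q (insertPair E a b) S T) ∧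
        (∀ b, ∃ a, BF M N q (insertPair E a b) S T)) ∧
      ((∀ P, ∃ P', BF M N q E (insertPair S P P') T) ∧
        (∀ P', ∃ P, BF M N q E (insertPair S P P') T)) ∧
      ((∀ Q, M.SubEdge Q → ∃ Q', N.SubEdge Q' ∧ BF M N q E S (insertPair T Q Q')) ∧
        (∀ Q', N.SubEdge Q' → ∃ Q, M.SubEdge Q ∧ BF M N q E S (insertPair T Q Q')))

theorem insertPair_mono {α β : Type} {R R' : α → β → Prop} (h : ∀ x y, R' x y → R x y) (a : α) (b : β) :
    ∀ x y, insertPair R' a b x y → insertPair R a b x y :=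
  fun x y => Or.imp (h x y) id

theorem AtomicAgree.mono {M : Str n A} {N : Str n B} {E E' S S' T T'}
    (h : AtomicAgree M N E S T) (hE : ∀ x y, E' x y → E x y) (hS : ∀ x y, S' x y → S x y)
    (hT : ∀ x y, T' x y → T x y) : AtomicAgree M N E' S' T' where
  eq h1 h2 := h.eq (hE _ _ h1) (hE _ _ h2)
  un h1 := h.un (hE _ _ h1)
  edge h1 h2 := h.edge (hE _ _ h1) (hE _ _ h2)
  mem h1 h2 := h.mem (hS _ _ h1) (hE _ _ h2)
  rel h0 h1 h2 := h.rel (hT _ _ h0) (hE _ _ h1) (hE _ _ h2)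

/-- Smaller correspondences impose fewer conditions. This is how a played pair is dropped, or a
correspondence replaced by the one that a strategy expects. -/
theorem BF.mono {M : Str n A} {N : Str n B} {q : ℕ} {E E' S S' T T'}
    (h : BF M N q E S T) (hE : ∀ x y, E' x y → E x y) (hS : ∀ x y, S' x y → S x y)
    (hT : ∀ x y, T' x y → T x y) : BF M N q E' S' T' := by
  induction q generalizing E E' S S' T T' with
  | zero => exact AtomicAgree.mono h hE hS hT
  | succ q ih =>
    obtain ⟨h0, ⟨h1, h2⟩, ⟨h3, h4⟩, h5, h6⟩ := h
    refine ⟨h0.mono hE hS hT, ⟨fun a => ?_, fun b => ?_⟩, ⟨fun a => ?_, fun b => ?_⟩,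
      fun a ha => ?_, fun b hb => ?_⟩
    · exact (h1 a).imp fun b h => ih h (insertPair_mono hE _ _) hS hT
    · exact (h2 b).imp fun b h => ih h (insertPair_mono hE _ _) hS hT
    · exact (h3 a).imp fun b h => ih h hE (insertPair_mono hS _ _) hT
    · exact (h4 b).imp fun b h => ih h hE (insertPair_mono hS _ _) hT
    · exact (h5 a ha).imp fun b h => ⟨h.1, ih h.2 hE hS (insertPair_mono hT _ _)⟩
    · exact (h6 b hb).imp fun b h => ⟨h.1, ih h.2 hE hS (insertPair_mono hT _ _)⟩

theorem BF.atomic {M : Str n A} {N : Str n B} {q : ℕ} {E S T}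
    (h : BF M N q E S T) : AtomicAgree M N E S T := by
  cases q with
  | zero => exact h
  | succ q => exact h.1

/-- The surplus round is spent on an arbitrary set move, and the resulting pair is then forgotten. A
set move is possible even on an empty universe. -/
theorem BF.of_succ {M : Str n A} {N : Str n B} {q : ℕ} {E S T}
    (h : BF M N (q + 1) E S T) : BF M N q E S T := by
  obtain ⟨_, -, ⟨h3, -⟩, -⟩ := h
  obtain ⟨P', h⟩ := h3 fun _ => True
  exact h.mono (fun _ _ => id) (fun _ _ => Or.inl) (fun _ _ => id)

theorem insertPair_flip {α β : Type} {R : α → β → Prop} (a : α) (b : β) (x : α) (y : β) :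
    insertPair (flip R) b a y x ↔ insertPair R a b x y := by
  simp [insertPair, flip, and_comm]

theorem AtomicAgree.symm {M : Str n A} {N : Str n B} {E S T}
    (h : AtomicAgree M N E S T) : AtomicAgree N M (flip E) (flip S) (flip T) where
  eq h1 h2 := (h.eq h1 h2).symm
  un h1 i := (h.un h1 i).symm
  edge h1 h2 := (h.edge h1 h2).symm
  mem h1 h2 := (h.mem h1 h2).symm
  rel h0 h1 h2 := (h.rel h0 h1 h2).symm

/-- Allows the games on joins to be analysed for moves in one of the two structures only. -/
theorem BF.symm {M : Str n A} {N : Str n B} {q : ℕ} {E S T}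
    (h : BF M N q E S T) : BF N M q (flip E) (flip S) (flip T) := by
  induction q generalizing E S T with
  | zero => exact AtomicAgree.symm h
  | succ q ih =>
    have i {α β : Type} {R : α → β → Prop} (a : α) (b : β) (y : β) (x : α) :
      insertPair (flip R) b a y x → flip (insertPair R a b) y x := (insertPair_flip a b x y).1
    obtain ⟨h0, ⟨h1, h2⟩, ⟨h3, h4⟩, h5, h6⟩ := h
    refine ⟨h0.symm, ⟨fun a => ?_, fun b => ?_⟩, ⟨fun a => ?_, fun b => ?_⟩,
      fun a ha => ?_, fun b hb => ?_⟩
    · exact (h2 a).imp fun b h => (ih h).mono (i _ _) (fun _ _ => id) (fun _ _ => id)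
    · exact (h1 b).imp fun b h => (ih h).mono (i _ _) (fun _ _ => id) (fun _ _ => id)
    · exact (h4 a).imp fun b h => (ih h).mono (fun _ _ => id) (i _ _) (fun _ _ => id)
    · exact (h3 b).imp fun b h => (ih h).mono (fun _ _ => id) (i _ _) (fun _ _ => id)
    · exact (h6 a ha).imp fun b h => ⟨h.1, (ih h.2).mono (fun _ _ => id) (fun _ _ => id) (i _ _)⟩
    · exact (h5 b hb).imp fun b h => ⟨h.1, (ih h.2).mono (fun _ _ => id) (fun _ _ => id) (i _ _)⟩

/-- An isomorphism gives back-and-forth equivalence of every rank. -/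
theorem BF.of_equiv {M : Str n A} {N : Str n B} (f : A ≃ B) (hs : ∀ x y, M.s x y ↔ N.s (f x) (f y))
    (hU : ∀ i x, M.U i x ↔ N.U i (f x)) (q : ℕ) :
    BF M N q (fun x y => y = f x) (fun P P' => ∀ x, P x ↔ P' (f x))
      (fun Q Q' => ∀ x y, Q x y ↔ Q' (f x) (f y)) := by
  have h0 : AtomicAgree M N (fun x y => y = f x) (fun P P' => ∀ x, P x ↔ P' (f x))
      (fun Q Q' => ∀ x y, Q x y ↔ Q' (f x) (f y)) := by
    constructor
    · rintro x _ x' _ rfl rfl; simp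
    · rintro x _ rfl i; exact hU i x
    · rintro x _ x' _ rfl rfl; exact hs x x'
    · rintro P P' x _ h rfl; exact h x
    · rintro Q Q' x _ x' _ h rfl rfl; exact h x x'
  induction q with
  | zero => exact h0
  | succ q ih =>
    -- Answers are images under `f`, so each played pair already belongs to the full correspondence
    -- and the induction hypothesis applies unchanged.
    have i {α β : Type} {R : α → β → Prop} {a : α} {b : β} (h : R a b) (x : α) (y : β) :
      insertPair R a b x y → R x y := by
      rintro (h' | ⟨rfl, rfl⟩) <;> assumption
    refine ⟨h0, ⟨fun a => ⟨f a, ?_⟩, fun b => ⟨f.symm b, ?_⟩⟩, ⟨fun P => ⟨P ∘ f.symm, ?_⟩,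
      fun P => ⟨P ∘ f, ?_⟩⟩, fun Q hQ => ⟨fun x y => Q (f.symm x) (f.symm y), fun x y h => ?_, ?_⟩,
      fun Q hQ => ⟨fun x y => Q (f x) (f y), fun x y h => ?_, ?_⟩⟩
    · exact ih.mono (i rfl) (fun _ _ => id) (fun _ _ => id)
    · exact ih.mono (i (by simp)) (fun _ _ => id) (fun _ _ => id)
    · exact ih.mono (fun _ _ => id) (i (by simp)) (fun _ _ => id)
    · exact ih.mono (fun _ _ => id) (i (by simp)) (fun _ _ => id)
    · simpa using (hs _ _).1 (hQ _ _ h)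
    · exact ih.mono (fun _ _ => id) (fun _ _ => id) (i (by simp))
    · exact (hs _ _).2 (hQ _ _ h)
    · exact ih.mono (fun _ _ => id) (fun _ _ => id) (i (by simp))

/-- The assignments `g`, `g'` correspond under `R` on the variables in `V`. -/
def CorrOn {α β : Type} (V : Finset ℕ) (R : α → β → Prop) (g : ℕ → α) (g' : ℕ → β) : Prop :=
  ∀ i ∈ V, R (g i) (g' i)

/-- A variable may be quantified again inside its own scope. Its old pair then stays in the
correspondence as an extra constraint, which does no harm. -/
theorem CorrOn.update {α β : Type} {V : Finset ℕ} {R : α → β → Prop} {g : ℕ → α} {g' : ℕ → β}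
    (h : CorrOn V R g g') (x : ℕ) (a : α) (b : β) :
    CorrOn (insert x V) (insertPair R a b) (Function.update g x a) (Function.update g' x b) := by
  intro i hi
  by_cases hx : i = x
  · subst hx; simp [insertPair]
  · rw [Function.update_of_ne hx, Function.update_of_ne hx]
    exact Or.inl (h i ((Finset.mem_insert.1 hi).resolve_left hx))

/-- Formulas of quantifier rank at most `q` are preserved by back-and-forth equivalence of rank
`q`. -/
theorem BF.sat_iff {M : Str n A} {N : Str n B} {q : ℕ} {E S T} (h : BF M N q E S T)
    {φ : MSO n} (hφ : φ.qr ≤ q) {VE VS VT : Finset ℕ} (hF : φ.FreeIn VE VS VT)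
    {g g'} (hE : CorrOn VE E g g') {k k'} (hS : CorrOn VS S k k')
    {l l'} (hT : CorrOn VT T l l') : φ.Sat M g k l ↔ φ.Sat N g' k' l' := by
  induction φ generalizing q E S T VE VS VT g g' k k' l l' with
  | bot => exact Iff.rfl
  | eq x y => exact h.atomic.eq (hE _ hF.1) (hE _ hF.2)
  | un i x => exact h.atomic.un (hE _ hF) i
  | edge x y => exact h.atomic.edge (hE _ hF.1) (hE _ hF.2)
  | mem X x => exact h.atomic.mem (hS _ hF.1) (hE _ hF.2)
  | rel R x y => exact h.atomic.rel (hT _ hF.1) (hE _ hF.2.1) (hE _ hF.2.2)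
  | neg φ ih => exact not_congr (ih h hφ hF hE hS hT)
  | and φ ψ ih1 ih2 =>
    simp only [MSO.qr, max_le_iff] at hφ
    exact and_congr (ih1 h hφ.1 hF.1 hE hS hT) (ih2 h hφ.2 hF.2 hE hS hT)
  | or φ ψ ih1 ih2 =>
    simp only [MSO.qr, max_le_iff] at hφ
    exact or_congr (ih1 h hφ.1 hF.1 hE hS hT) (ih2 h hφ.2 hF.2 hE hS hT)
  | exElt x φ ih =>
    obtain _ | q := q
    · simp [MSO.qr] at hφ
    obtain ⟨-, ⟨h1, h2⟩, -⟩ := h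
    have hφ' : φ.qr ≤ q := by simpa [MSO.qr] using hφ
    constructor
    · rintro ⟨a, ha⟩
      obtain ⟨b, hb⟩ := h1 a
      exact ⟨b, (ih hb hφ' hF (hE.update x a b) hS hT).1 ha⟩
    · rintro ⟨b, hb⟩
      obtain ⟨a, ha⟩ := h2 b
      exact ⟨a, (ih ha hφ' hF (hE.update x a b) hS hT).2 hb⟩
  | allElt x φ ih =>
    obtain _ | q := q
    · simp [MSO.qr] at hφ
    obtain ⟨-, ⟨h1, h2⟩, -⟩ := h
    have hφ' : φ.qr ≤ q := by simpa [MSO.qr] using hφ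
    constructor
    · intro H b
      obtain ⟨a, ha⟩ := h2 b
      exact (ih ha hφ' hF (hE.update x a b) hS hT).1 (H a)
    · intro H a
      obtain ⟨b, hb⟩ := h1 a
      exact (ih hb hφ' hF (hE.update x a b) hS hT).2 (H b)
  | exSet x φ ih =>
    obtain _ | q := q
    · simp [MSO.qr] at hφ
    obtain ⟨-, -, ⟨h1, h2⟩, -⟩ := h
    have hφ' : φ.qr ≤ q := by simpa [MSO.qr] using hφ
    constructor
    · rintro ⟨a, ha⟩
      obtain ⟨b, hb⟩ := h1 a
      exact ⟨b, (ih hb hφ' hF hE (hS.update x a b) hT).1 ha⟩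
    · rintro ⟨b, hb⟩
      obtain ⟨a, ha⟩ := h2 b
      exact ⟨a, (ih ha hφ' hF hE (hS.update x a b) hT).2 hb⟩
  | allSet x φ ih =>
    obtain _ | q := q
    · simp [MSO.qr] at hφ
    obtain ⟨-, -, ⟨h1, h2⟩, -⟩ := h
    have hφ' : φ.qr ≤ q := by simpa [MSO.qr] using hφ
    constructor
    · intro H b
      obtain ⟨a, ha⟩ := h2 b
      exact (ih ha hφ' hF hE (hS.update x a b) hT).1 (H a)
    · intro H a
      obtain ⟨b, hb⟩ := h1 a
      exact (ih hb hφ' hF hE (hS.update x a b) hT).2 (H b)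
  | exRel x φ ih =>
    obtain _ | q := q
    · simp [MSO.qr] at hφ
    obtain ⟨-, -, -, h1, h2⟩ := h
    have hφ' : φ.qr ≤ q := by simpa [MSO.qr] using hφ
    constructor
    · rintro ⟨a, ha', ha⟩
      obtain ⟨b, hb', hb⟩ := h1 a ha'
      exact ⟨b, hb', (ih hb hφ' hF hE hS (hT.update x a b)).1 ha⟩
    · rintro ⟨b, hb', hb⟩
      obtain ⟨a, ha', ha⟩ := h2 b hb'
      exact ⟨a, ha', (ih ha hφ' hF hE hS (hT.update x a b)).2 hb⟩
  | allRel x φ ih =>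
    obtain _ | q := q
    · simp [MSO.qr] at hφ
    obtain ⟨-, -, -, h1, h2⟩ := h
    have hφ' : φ.qr ≤ q := by simpa [MSO.qr] using hφ
    constructor
    · intro H b hb
      obtain ⟨a, ha', ha⟩ := h2 b hb
      exact (ih ha hφ' hF hE hS (hT.update x a b)).1 (H a ha')
    · intro H a ha
      obtain ⟨b, hb', hb⟩ := h1 a ha
      exact (ih hb hφ' hF hE hS (hT.update x a b)).2 (H b hb')

/-- Equivalence of structures for sentences of quantifier rank at most `q`. -/
def Str.EquivRank (q : ℕ) (M : Str n A) (N : Str n B) : Prop :=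
  BF M N q (fun _ _ => False) (fun _ _ => False) (fun _ _ => False)

theorem Str.EquivRank.of_equiv {M : Str n A} {N : Str n B} (f : A ≃ B)
    (hs : ∀ x y, M.s x y ↔ N.s (f x) (f y)) (hU : ∀ i x, M.U i x ↔ N.U i (f x)) (q : ℕ) :
    M.EquivRank q N :=
  (BF.of_equiv f hs hU q).mono (fun _ _ => False.elim) (fun _ _ => False.elim)
    (fun _ _ => False.elim)

theorem Str.EquivRank.sat_iff {q : ℕ} {M : Str n A} {N : Str n B} (h : M.EquivRank q N)
    {φ : MSO n} (hφ : φ.IsSentence) (hq : φ.qr ≤ q) (e S T e' S' T') :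
    φ.Sat M e S T ↔ φ.Sat N e' S' T' :=
  BF.sat_iff h hq hφ (by simp [CorrOn]) (by simp [CorrOn]) (by simp [CorrOn])

/-- The identity is an isomorphism, and the game equivalence it gives with empty correspondences
compares any two assignments. -/
theorem MSO.IsSentence.models_iff_sat {φ : MSO n} (hφ : φ.IsSentence) (M : Str n A) (e S T) :
    M.Models φ ↔ φ.Sat M e S T :=
  ⟨fun h => h e S T, fun h e' S' T' => ((Str.EquivRank.of_equiv (Equiv.refl A)
    (fun _ _ => Iff.rfl) (fun _ _ => Iff.rfl) φ.qr).sat_iff hφ le_rfl e S T e' S' T').1 h⟩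

theorem Str.EquivRank.models_iff [Nonempty A] [Nonempty B] {q : ℕ} {M : Str n A} {N : Str n B}
    (h : M.EquivRank q N) {φ : MSO n} (hφ : φ.IsSentence) (hq : φ.qr ≤ q) :
    M.Models φ ↔ N.Models φ := by
  obtain ⟨a⟩ := ‹Nonempty A›
  obtain ⟨b⟩ := ‹Nonempty B›
  rw [hφ.models_iff_sat M (fun _ => a) (fun _ _ => True) (fun _ _ _ => True),
    hφ.models_iff_sat N (fun _ => b) (fun _ _ => True) (fun _ _ _ => True)]
  exact h.sat_iff hφ hq ..

end BackAndForth

/-! ### Hintikka formulas -/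

namespace MSO

variable {n : ℕ} {A B : Type}

/-- All conjunctions of the members of a list or their negations. -/
def signs : List (MSO n) → List (MSO n)
  | [] => [.neg .bot]
  | φ :: L => (signs L).map (.and φ) ++ (signs L).map (.and (.neg φ))

theorem nodup_signs (L : List (MSO n)) : (signs L).Nodup := by
  induction L with
  | nil => simp [signs]
  | cons φ L ih =>
    refine List.Nodup.append (ih.map fun _ _ h => by simpa using h)
      (ih.map fun _ _ h => by simpa using h) ?_
    intro ψ h1 h2
    simp only [List.mem_map] at h1 h2
    obtain ⟨a, -, rfl⟩ := h1
    obtain ⟨b, -, h⟩ := h2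
    simp only [MSO.and.injEq] at h
    -- A formula never equals its own negation, because their sizes differ.
    have := congrArg sizeOf h.1
    simp at this

theorem existsUnique_signs (L : List (MSO n)) (M : Str n A) (e S T) :
    ∃! φ, φ ∈ signs L ∧ φ.Sat M e S T := by
  induction L with
  | nil => exact ⟨.neg .bot, by simp [signs, Sat], by simp [signs]⟩
  | cons φ L ih =>
    obtain ⟨ψ, ⟨h1, h2⟩, h3⟩ := ih
    by_cases h : φ.Sat M e S T
    · refine ⟨.and φ ψ, ⟨by simp [signs, h1], h, h2⟩, ?_⟩
      rintro χ ⟨hm, hs⟩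
      simp only [signs, List.mem_append, List.mem_map] at hm
      obtain ⟨a, ha, rfl⟩ | ⟨a, ha, rfl⟩ := hm
      · rw [h3 a ⟨ha, hs.2⟩]
      · exact absurd h hs.1
    · refine ⟨.and (.neg φ) ψ, ⟨by simp [signs, h1], h, h2⟩, ?_⟩
      rintro χ ⟨hm, hs⟩
      simp only [signs, List.mem_append, List.mem_map] at hm
      obtain ⟨a, ha, rfl⟩ | ⟨a, ha, rfl⟩ := hm
      · exact absurd hs.1 h
      · rw [h3 a ⟨ha, hs.2⟩]

theorem sat_iff_of_signs {L : List (MSO n)} {φ : MSO n} (hφ : φ ∈ signs L) {M : Str n A}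
    {N : Str n B} {e S T e' S' T'} (hM : φ.Sat M e S T) (hN : φ.Sat N e' S' T') :
    ∀ ψ ∈ L, ψ.Sat M e S T ↔ ψ.Sat N e' S' T' := by
  induction L generalizing φ with
  | nil => simp
  | cons χ L ih =>
    simp only [signs, List.mem_append, List.mem_map] at hφ
    rw [List.forall_mem_cons]
    obtain ⟨a, ha, rfl⟩ | ⟨a, ha, rfl⟩ := hφ
    · exact ⟨iff_of_true hM.1 hN.1, ih ha hM.2 hN.2⟩
    · exact ⟨iff_of_false hM.1 hN.1, ih ha hM.2 hN.2⟩

theorem freeIn_signs {L : List (MSO n)} {E S T : Finset ℕ} (h : ∀ φ ∈ L, φ.FreeIn E S T) :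
    ∀ φ ∈ signs L, φ.FreeIn E S T := by
  induction L with
  | nil => simp [signs, FreeIn]
  | cons χ L ih =>
    rw [List.forall_mem_cons] at h
    intro φ hφ
    simp only [signs, List.mem_append, List.mem_map] at hφ
    obtain ⟨a, ha, rfl⟩ | ⟨a, ha, rfl⟩ := hφ
    · exact ⟨h.1, ih h.2 a ha⟩
    · exact ⟨h.1, ih h.2 a ha⟩

theorem qr_signs {L : List (MSO n)} {q : ℕ} (h : ∀ φ ∈ L, φ.qr ≤ q) :
    ∀ φ ∈ signs L, φ.qr ≤ q := by
  induction L with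
  | nil => simp [signs, qr]
  | cons χ L ih =>
    rw [List.forall_mem_cons] at h
    intro φ hφ
    simp only [signs, List.mem_append, List.mem_map] at hφ
    obtain ⟨a, ha, rfl⟩ | ⟨a, ha, rfl⟩ := hφ
    · exact max_le h.1 (ih h.2 a ha)
    · exact max_le h.1 (ih h.2 a ha)

/-- The atomic formulas in the first `a` element, `b` set and `c` relation variables. -/
def atoms (n a b c : ℕ) : List (MSO n) :=
  (List.range a).flatMap fun x =>
    (List.finRange n).map (fun i => un i x) ++
    ((List.range b).map (fun X => mem X x) ++
    (List.range a).flatMap fun y =>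
      eq x y :: edge x y :: (List.range c).map fun R => rel R x y)

/-- The Hintikka formulas of rank `q` in the first `a` element, `b` set and `c` relation
variables. -/
def hin (n : ℕ) : ℕ → ℕ → ℕ → ℕ → List (MSO n)
  | 0, a, b, c => signs (atoms n a b c)
  | q + 1, a, b, c => signs (atoms n a b c ++ ((hin n q (a + 1) b c).map (exElt a) ++
      ((hin n q a (b + 1) c).map (exSet b) ++ (hin n q a b (c + 1)).map (exRel c))))

theorem nodup_hin (q a b c : ℕ) : (hin n q a b c).Nodup := by
  cases q <;> exact nodup_signs _

theorem freeIn_atoms (a b c : ℕ) :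
    ∀ φ ∈ atoms n a b c, φ.FreeIn (.range a) (.range b) (.range c) := by
  intro φ hφ
  simp only [atoms, List.mem_flatMap, List.mem_append, List.mem_map, List.mem_range,
    List.mem_cons] at hφ
  obtain ⟨x, hx, ⟨i, -, rfl⟩ | ⟨X, hX, rfl⟩ | ⟨y, hy, rfl | rfl | ⟨R, hR, rfl⟩⟩⟩ := hφ <;>
    simp_all [FreeIn]

theorem qr_atoms (a b c : ℕ) : ∀ φ ∈ atoms n a b c, φ.qr ≤ 0 := by
  intro φ hφ
  simp only [atoms, List.mem_flatMap, List.mem_append, List.mem_map, List.mem_range,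
    List.mem_cons] at hφ
  obtain ⟨x, hx, ⟨i, -, rfl⟩ | ⟨X, hX, rfl⟩ | ⟨y, hy, rfl | rfl | ⟨R, hR, rfl⟩⟩⟩ := hφ <;>
    simp [qr]

theorem freeIn_hin (q a b c : ℕ) :
    ∀ φ ∈ hin n q a b c, φ.FreeIn (.range a) (.range b) (.range c) := by
  induction q generalizing a b c with
  | zero => exact freeIn_signs (freeIn_atoms a b c)
  | succ q ih =>
    refine freeIn_signs fun φ hφ => ?_
    simp only [List.mem_append, List.mem_map] at hφ
    obtain h | ⟨ψ, h, rfl⟩ | ⟨ψ, h, rfl⟩ | ⟨ψ, h, rfl⟩ := hφ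
    · exact freeIn_atoms a b c φ h
    all_goals simpa [FreeIn, Finset.range_add_one] using ih _ _ _ ψ h

theorem qr_hin (q a b c : ℕ) : ∀ φ ∈ hin n q a b c, φ.qr ≤ q := by
  induction q generalizing a b c with
  | zero => exact qr_signs (qr_atoms a b c)
  | succ q ih =>
    refine qr_signs fun φ hφ => ?_
    simp only [List.mem_append, List.mem_map] at hφ
    obtain h | ⟨ψ, h, rfl⟩ | ⟨ψ, h, rfl⟩ | ⟨ψ, h, rfl⟩ := hφ
    · exact (qr_atoms a b c φ h).trans (Nat.zero_le _)
    all_goals simpa [qr] using ih _ _ _ ψ h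

theorem existsUnique_hin (q a b c : ℕ) (M : Str n A) (e S T) :
    ∃! φ, φ ∈ hin n q a b c ∧ φ.Sat M e S T := by
  cases q <;> exact existsUnique_signs _ M e S T

/-- The correspondence between the values of the first `a` variables under two assignments. -/
def prefixCorr {α β : Type} (a : ℕ) (e : ℕ → α) (e' : ℕ → β) : α → β → Prop :=
  fun x y => ∃ i < a, x = e i ∧ y = e' i

theorem insertPair_prefixCorr {α β : Type} (a : ℕ) (e : ℕ → α) (e' : ℕ → β) (p : α) (p' : β) :
    ∀ x y, insertPair (prefixCorr a e e') p p' x y →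
      prefixCorr (a + 1) (Function.update e a p) (Function.update e' a p') x y := by
  rintro x y (⟨i, hi, rfl, rfl⟩ | ⟨rfl, rfl⟩)
  · exact ⟨i, by omega, by simp [Function.update_of_ne hi.ne],
      by simp [Function.update_of_ne hi.ne]⟩
  · exact ⟨a, by omega, by simp, by simp⟩

theorem atomicAgree_of_atoms {a b c : ℕ} {M : Str n A} {N : Str n B} {e S T e' S' T'}
    (h : ∀ ψ ∈ atoms n a b c, ψ.Sat M e S T ↔ ψ.Sat N e' S' T') :
    AtomicAgree M N (prefixCorr a e e') (prefixCorr b S S') (prefixCorr c T T') := by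
  constructor
  · rintro _ _ _ _ ⟨i, hi, rfl, rfl⟩ ⟨j, hj, rfl, rfl⟩
    exact h (.eq i j) (by simp [atoms, hi, hj])
  · rintro _ _ ⟨i, hi, rfl, rfl⟩ l
    exact h (.un l i) (by simp [atoms, hi])
  · rintro _ _ _ _ ⟨i, hi, rfl, rfl⟩ ⟨j, hj, rfl, rfl⟩
    exact h (.edge i j) (by simp [atoms, hi, hj])
  · rintro _ _ _ _ ⟨X, hX, rfl, rfl⟩ ⟨j, hj, rfl, rfl⟩
    exact h (.mem X j) (by simp [atoms, hX, hj])
  · rintro _ _ _ _ _ _ ⟨R, hR, rfl, rfl⟩ ⟨i, hi, rfl, rfl⟩ ⟨j, hj, rfl, rfl⟩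
    exact h (.rel R i j) (by simp [atoms, hi, hj, hR])

/-- Two structures that satisfy the same Hintikka formula are back-and-forth equivalent. -/
theorem bf_of_hin {q a b c : ℕ} {M : Str n A} {N : Str n B} {e S T e' S' T'} {φ : MSO n}
    (hφ : φ ∈ hin n q a b c) (hM : φ.Sat M e S T) (hN : φ.Sat N e' S' T') :
    BF M N q (prefixCorr a e e') (prefixCorr b S S') (prefixCorr c T T') := by
  induction q generalizing a b c e S T e' S' T' φ with
  | zero => exact atomicAgree_of_atoms (sat_iff_of_signs hφ hM hN)
  | succ q ih =>
    have key := sat_iff_of_signs hφ hM hN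
    simp only [List.mem_append, List.mem_map, or_imp, forall_and, forall_exists_index, and_imp,
      forall_apply_eq_imp_iff₂] at key
    obtain ⟨k0, k1, k2, k3⟩ := key
    refine ⟨atomicAgree_of_atoms k0, ⟨fun p => ?_, fun p => ?_⟩, ⟨fun p => ?_, fun p => ?_⟩,
      fun p hp => ?_, fun p hp => ?_⟩
    -- The position after the move satisfies some Hintikka formula of rank `q`. Its existential
    -- closure is among the signed formulas, so it holds on the other side too, and any witness
    -- there is a good answer. All six cases follow this pattern.
    · obtain ⟨ψ, ⟨h1, h2⟩, -⟩ := existsUnique_hin q (a + 1) b c M (Function.update e a p) S T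
      obtain ⟨p', h3⟩ := (k1 ψ h1).1 ⟨p, h2⟩
      exact ⟨p', (ih h1 h2 h3).mono (insertPair_prefixCorr _ _ _ _ _) (fun _ _ => id) (fun _ _ => id)⟩
    · obtain ⟨ψ, ⟨h1, h2⟩, -⟩ := existsUnique_hin q (a + 1) b c N (Function.update e' a p) S' T'
      obtain ⟨p', h3⟩ := (k1 ψ h1).2 ⟨p, h2⟩
      exact ⟨p', (ih h1 h3 h2).mono (insertPair_prefixCorr _ _ _ _ _) (fun _ _ => id) (fun _ _ => id)⟩
    · obtain ⟨ψ, ⟨h1, h2⟩, -⟩ := existsUnique_hin q a (b + 1) c M e (Function.update S b p) T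
      obtain ⟨p', h3⟩ := (k2 ψ h1).1 ⟨p, h2⟩
      exact ⟨p', (ih h1 h2 h3).mono (fun _ _ => id) (insertPair_prefixCorr _ _ _ _ _) (fun _ _ => id)⟩
    · obtain ⟨ψ, ⟨h1, h2⟩, -⟩ := existsUnique_hin q a (b + 1) c N e' (Function.update S' b p) T'
      obtain ⟨p', h3⟩ := (k2 ψ h1).2 ⟨p, h2⟩
      exact ⟨p', (ih h1 h3 h2).mono (fun _ _ => id) (insertPair_prefixCorr _ _ _ _ _) (fun _ _ => id)⟩
    · obtain ⟨ψ, ⟨h1, h2⟩, -⟩ := existsUnique_hin q a b (c + 1) M e S (Function.update T c p)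
      obtain ⟨p', hp', h3⟩ := (k3 ψ h1).1 ⟨p, hp, h2⟩
      exact ⟨p', hp', (ih h1 h2 h3).mono (fun _ _ => id) (fun _ _ => id)
        (insertPair_prefixCorr _ _ _ _ _)⟩
    · obtain ⟨ψ, ⟨h1, h2⟩, -⟩ := existsUnique_hin q a b (c + 1) N e' S' (Function.update T' c p)
      obtain ⟨p', hp', h3⟩ := (k3 ψ h1).2 ⟨p, hp, h2⟩
      exact ⟨p', hp', (ih h1 h3 h2).mono (fun _ _ => id) (fun _ _ => id)
        (insertPair_prefixCorr _ _ _ _ _)⟩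

theorem isSentence_hin {q : ℕ} {φ : MSO n} (h : φ ∈ hin n q 0 0 0) : φ.IsSentence := by
  simpa [IsSentence] using freeIn_hin q 0 0 0 φ h

theorem existsUnique_models_hin (q : ℕ) [Nonempty A] (M : Str n A) :
    ∃! φ, φ ∈ hin n q 0 0 0 ∧ M.Models φ := by
  obtain ⟨a⟩ := ‹Nonempty A›
  have hs (φ) (h : φ ∈ hin n q 0 0 0) := (isSentence_hin h).models_iff_sat M
    (fun _ => a) (fun _ _ => True) (fun _ _ _ => True)
  obtain ⟨φ, ⟨h1, h2⟩, h3⟩ := existsUnique_hin q 0 0 0 M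
    (fun _ => a) (fun _ _ => True) (fun _ _ _ => True)
  exact ⟨φ, ⟨h1, (hs φ h1).2 h2⟩, fun ψ hψ => h3 ψ ⟨hψ.1, (hs ψ hψ.1).1 hψ.2⟩⟩

theorem equivRank_of_hin [Nonempty A] [Nonempty B] {q : ℕ} {M : Str n A} {N : Str n B} {φ : MSO n}
    (hφ : φ ∈ hin n q 0 0 0) (hM : M.Models φ) (hN : N.Models φ) : M.EquivRank q N := by
  obtain ⟨a⟩ := ‹Nonempty A›
  obtain ⟨b⟩ := ‹Nonempty B›
  exact (bf_of_hin hφ (hM (fun _ => a) (fun _ _ => True) (fun _ _ _ => True))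
    (hN (fun _ => b) (fun _ _ => True) (fun _ _ _ => True))).mono
    (fun _ _ => False.elim) (fun _ _ => False.elim) (fun _ _ => False.elim)

/-- All models of one Hintikka sentence are game equivalent, so a sentence of rank at most `q` holds
in all of them or in none. It is thus the disjunction of the members that entail it. -/
theorem isHintikkaSet_hin (n q : ℕ) : IsHintikkaSet q (hin n q 0 0 0) where
  nodup := nodup_hin _ _ _ _
  sentence ε hε := ⟨isSentence_hin hε, qr_hin _ _ _ _ ε hε⟩
  existsUnique A _ _ M := existsUnique_models_hin q M
  disjunction ω hω hq := by
    refine ⟨{ε | ε ∈ hin n q 0 0 0 ∧ ε.Entails ω}, fun ε h => h.1, fun A _ _ M => ⟨fun h => ?_, ?_⟩⟩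
    · obtain ⟨ε, ⟨h1, h2⟩, -⟩ := existsUnique_models_hin q M
      exact ⟨ε, ⟨h1, fun B _ _ N hN => ((equivRank_of_hin h1 h2 hN).models_iff hω hq).1 h⟩, h2⟩
    · rintro ⟨ε, hε, h⟩
      exact hε.2 A M h

end MSO

/-- Two structures that satisfy the same member of a Hintikka set of rank `q` are equivalent for
rank `q`. -/
theorem IsHintikkaSet.equivRank {n q : ℕ} {H : List (MSO n)} (hH : IsHintikkaSet q H) {A B : Type}
    [Finite A] [Nonempty A] [Finite B] [Nonempty B] {M : Str n A} {N : Str n B} {ε : MSO n}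
    (hε : ε ∈ H) (hM : M.Models ε) (hN : N.Models ε) : M.EquivRank q N := by
  -- The canonical Hintikka sentence `χ` of `M` is a disjunction of members of `H`. The disjunct
  -- true in `M` must be `ε` by uniqueness, so `N` satisfies `χ` as well.
  obtain ⟨χ, ⟨h1, h2⟩, -⟩ := MSO.existsUnique_models_hin q M
  obtain ⟨S, hS, h⟩ := hH.disjunction χ (MSO.isSentence_hin h1) (MSO.qr_hin _ _ _ _ χ h1)
  obtain ⟨ε', h3, h4⟩ := (h A M).1 h2
  obtain rfl := (hH.existsUnique A M).unique ⟨hS _ h3, h4⟩ ⟨hε, hM⟩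
  exact MSO.equivRank_of_hin h1 h2 ((h B N).2 ⟨ε', h3, hN⟩)

/-! ### Composition: a fresh root on top of rooted structures -/

section Join

variable {n : ℕ} {A B I : Type} {α β : I → Type}

/-- The element `r` is the only one without predecessors. -/
def Str.IsRoot (M : Str n A) (r : A) : Prop := ∀ x, x = r ↔ ∀ y, ¬ M.s y x

/-- `M` consists of the element `u` and disjoint copies of the structures `C i`, where the
successors of `u` are the copies of the elements `r i`. -/
structure IsJoin (M : Str n A) (u : A) (C : ∀ i, Str n (α i)) (r : ∀ i, α i)
    (f : ∀ i, α i → A) : Prop where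
  inj : ∀ i, Function.Injective (f i)
  disj : ∀ {i j x y}, f i x = f j y → i = j
  ne : ∀ i x, f i x ≠ u
  cover : ∀ x, x = u ∨ ∃ i a, x = f i a
  edge : ∀ i x y, M.s (f i x) (f i y) ↔ (C i).s x y
  edge_cross : ∀ {i j x y}, M.s (f i x) (f j y) → i = j
  edge_root : ∀ i x, M.s u (f i x) ↔ x = r i
  edge_to_root : ∀ x, ¬ M.s x u
  un : ∀ l i x, M.U l (f i x) ↔ (C i).U l x
  root : ∀ i, (C i).IsRoot (r i)

/-- One round suffices to expose an element that is not the root: play a predecessor of it. -/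
theorem BF.root_iff {M : Str n A} {N : Str n B} {q E S T} (h : BF M N (q + 1) E S T)
    {r : A} {r' : B} (hr : M.IsRoot r) (hr' : N.IsRoot r') {x y} (hxy : E x y) :
    x = r ↔ y = r' := by
  rw [hr, hr', ← not_iff_not]
  push Not
  obtain ⟨-, ⟨h1, h2⟩, -⟩ := h
  constructor
  · rintro ⟨a, ha⟩
    obtain ⟨b, hb⟩ := h1 a
    exact ⟨b, (hb.atomic.edge (Or.inr ⟨rfl, rfl⟩) (Or.inl hxy)).1 ha⟩
  · rintro ⟨a, ha⟩
    obtain ⟨b, hb⟩ := h2 a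
    exact ⟨b, (hb.atomic.edge (Or.inr ⟨rfl, rfl⟩) (Or.inl hxy)).2 ha⟩

/-- The correspondence of sets of components induced by a correspondence of sets of joins. -/
def restrSet {γ δ : Type} (f : γ → A) (g : δ → B) (S : (A → Prop) → (B → Prop) → Prop) :
    (γ → Prop) → (δ → Prop) → Prop :=
  fun p p' => ∃ P P', S P P' ∧ (∀ x, p x ↔ P (f x)) ∧ ∀ x, p' x ↔ P' (g x)

/-- The correspondence of relations of components induced by one of relations of joins. -/
def restrRel {γ δ : Type} (f : γ → A) (g : δ → B) (T : (A → A → Prop) → (B → B → Prop) → Prop) :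
    (γ → γ → Prop) → (δ → δ → Prop) → Prop :=
  fun p p' => ∃ P P', T P P' ∧ (∀ x y, p x y ↔ P (f x) (f y)) ∧ ∀ x y, p' x y ↔ P' (g x) (g y)

/-- The invariant of the game on two joins: the components are in winning positions, with one
additional round once the root has been played. -/
structure JoinPosition (M : Str n A) (N : Str n B) (u : A) (w : B) (C : ∀ i, Str n (α i))
    (D : ∀ i, Str n (β i)) (r : ∀ i, α i) (r' : ∀ i, β i) (f : ∀ i, α i → A) (g : ∀ i, β i → B)
    (q : ℕ) (E : A → B → Prop) (S : (A → Prop) → (B → Prop) → Prop)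
    (T : (A → A → Prop) → (B → B → Prop) → Prop) : Prop where
  comp : ∃ j, q ≤ j ∧ (E u w → q + 1 ≤ j) ∧ ∀ i, BF (C i) (D i) j
    (fun x y => E (f i x) (g i y)) (restrSet (f i) (g i) S) (restrRel (f i) (g i) T)
  elt : ∀ x y, E x y → (x = u ∧ y = w) ∨ ∃ i a b, x = f i a ∧ y = g i b
  set : ∀ P P', S P P' → (P u ↔ P' w)
  rel : ∀ Q Q', T Q Q' → M.SubEdge Q ∧ N.SubEdge Q' ∧ ∀ i, Q u (f i (r i)) ↔ Q' w (g i (r' i))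

variable {M : Str n A} {N : Str n B} {u : A} {w : B} {C : ∀ i, Str n (α i)} {D : ∀ i, Str n (β i)}
  {r : ∀ i, α i} {r' : ∀ i, β i} {f : ∀ i, α i → A} {g : ∀ i, β i → B} {q : ℕ} {E : A → B → Prop}
  {S : (A → Prop) → (B → Prop) → Prop} {T : (A → A → Prop) → (B → B → Prop) → Prop}

theorem JoinPosition.mono (h : JoinPosition M N u w C D r r' f g q E S T) {E' S' T'}
    (hE : ∀ x y, E' x y → E x y) (hS : ∀ x y, S' x y → S x y)
    (hT : ∀ x y, T' x y → T x y) : JoinPosition M N u w C D r r' f g q E' S' T' where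
  comp := by
    obtain ⟨j, h1, h2, h3⟩ := h.comp
    exact ⟨j, h1, fun h => h2 (hE _ _ h), fun i => (h3 i).mono (fun _ _ => hE _ _)
      (fun _ _ ⟨P, P', h, h'⟩ => ⟨P, P', hS _ _ h, h'⟩)
      (fun _ _ ⟨P, P', h, h'⟩ => ⟨P, P', hT _ _ h, h'⟩)⟩
  elt x y h' := h.elt x y (hE _ _ h')
  set P P' h' := h.set P P' (hS _ _ h')
  rel Q Q' h' := h.rel Q Q' (hT _ _ h')

theorem JoinPosition.symm (h : JoinPosition M N u w C D r r' f g q E S T) :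
    JoinPosition N M w u D C r' r g f q (flip E) (flip S) (flip T) where
  comp := by
    obtain ⟨j, h1, h2, h3⟩ := h.comp
    exact ⟨j, h1, h2, fun i => (h3 i).symm.mono (fun _ _ => id)
      (fun _ _ ⟨P, P', h, h1, h2⟩ => ⟨P', P, h, h2, h1⟩)
      (fun _ _ ⟨P, P', h, h1, h2⟩ => ⟨P', P, h, h2, h1⟩)⟩
  elt y x h' := by
    obtain ⟨rfl, rfl⟩ | ⟨i, a, b, rfl, rfl⟩ := h.elt x y h'
    · exact Or.inl ⟨rfl, rfl⟩
    · exact Or.inr ⟨i, b, a, rfl, rfl⟩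
  set P P' h' := (h.set P' P h').symm
  rel Q Q' h' := ⟨(h.rel Q' Q h').2.1, (h.rel Q' Q h').1, fun i => ((h.rel Q' Q h').2.2 i).symm⟩

/-- Atomic facts live inside one component or at the fresh root, except for edges from the fresh
root into a component. Such an edge ends in the component's root, and the spare round guaranteed
after the fresh root was played lets `BF.root_iff` recognise that root. -/
theorem JoinPosition.atomic (hM : IsJoin M u C r f) (hN : IsJoin N w D r' g)
    (hU : ∀ l, M.U l u ↔ N.U l w) (h : JoinPosition M N u w C D r r' f g q E S T) :
    AtomicAgree M N E S T := by
  obtain ⟨j, hj, hj', hc⟩ := h.comp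
  have hroot : ∀ i a b, E u w → E (f i a) (g i b) → (a = r i ↔ b = r' i) := by
    intro i a b h1 h2
    have := hj' h1
    obtain ⟨j, rfl⟩ : ∃ k, j = k + 1 := ⟨j - 1, by omega⟩
    exact (hc i).root_iff (hM.root i) (hN.root i) h2
  constructor
  · intro x y x' y' h1 h2
    obtain ⟨rfl, rfl⟩ | ⟨i, a, b, rfl, rfl⟩ := h.elt _ _ h1 <;>
    obtain ⟨rfl, rfl⟩ | ⟨i', a', b', rfl, rfl⟩ := h.elt _ _ h2
    · simp
    · exact iff_of_false (hM.ne _ _).symm (hN.ne _ _).symm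
    · exact iff_of_false (hM.ne _ _) (hN.ne _ _)
    · by_cases hi : i = i'
      · subst hi
        rw [(hM.inj i).eq_iff, (hN.inj i).eq_iff]
        exact (hc i).atomic.eq h1 h2
      · exact iff_of_false (fun h => hi (hM.disj h)) (fun h => hi (hN.disj h))
  · intro x y h1 l
    obtain ⟨rfl, rfl⟩ | ⟨i, a, b, rfl, rfl⟩ := h.elt _ _ h1
    · exact hU l
    · rw [hM.un, hN.un]
      exact (hc i).atomic.un h1 l
  · intro x y x' y' h1 h2
    obtain ⟨rfl, rfl⟩ | ⟨i', a', b', rfl, rfl⟩ := h.elt _ _ h2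
    · exact iff_of_false (hM.edge_to_root _) (hN.edge_to_root _)
    obtain ⟨rfl, rfl⟩ | ⟨i, a, b, rfl, rfl⟩ := h.elt _ _ h1
    · rw [hM.edge_root, hN.edge_root]
      exact hroot _ _ _ h1 h2
    · by_cases hi : i = i'
      · subst hi
        rw [hM.edge, hN.edge]
        exact (hc i).atomic.edge h1 h2
      · exact iff_of_false (fun h => hi (hM.edge_cross h)) (fun h => hi (hN.edge_cross h))
  · intro P P' x y hP h1
    obtain ⟨rfl, rfl⟩ | ⟨i, a, b, rfl, rfl⟩ := h.elt _ _ h1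
    · exact h.set P P' hP
    · exact (hc i).atomic.mem (P := fun x => P (f i x)) (P' := fun x => P' (g i x))
        ⟨P, P', hP, fun _ => Iff.rfl, fun _ => Iff.rfl⟩ h1
  · intro Q Q' x y x' y' hQ h1 h2
    obtain ⟨hQ1, hQ2, hQ3⟩ := h.rel _ _ hQ
    obtain ⟨rfl, rfl⟩ | ⟨i', a', b', rfl, rfl⟩ := h.elt _ _ h2
    · exact iff_of_false (fun h => hM.edge_to_root _ (hQ1 _ _ h))
        (fun h => hN.edge_to_root _ (hQ2 _ _ h))
    obtain ⟨rfl, rfl⟩ | ⟨i, a, b, rfl, rfl⟩ := h.elt _ _ h1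
    · by_cases ha : a' = r i'
      · have hb := (hroot _ _ _ h1 h2).1 ha
        subst ha hb
        exact hQ3 i'
      · have hb := mt (hroot _ _ _ h1 h2).2 ha
        exact iff_of_false (fun h => ha ((hM.edge_root _ _).1 (hQ1 _ _ h)))
          (fun h => hb ((hN.edge_root _ _).1 (hQ2 _ _ h)))
    · by_cases hi : i = i'
      · subst hi
        exact (hc i).atomic.rel (Q := fun x y => Q (f i x) (f i y))
          (Q' := fun x y => Q' (g i x) (g i y))
          ⟨Q, Q', hQ, fun _ _ => Iff.rfl, fun _ _ => Iff.rfl⟩ h1 h2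
      · exact iff_of_false (fun h => hi (hM.edge_cross (hQ1 _ _ h)))
          (fun h => hi (hN.edge_cross (hQ2 _ _ h)))

/-- The fresh root is answered by the fresh root, which leaves the component games untouched and so
creates the spare round. An element of a component is answered by that component's strategy, while
the other components give up a round. -/
theorem JoinPosition.exists_elt (hM : IsJoin M u C r f) (hN : IsJoin N w D r' g)
    (h : JoinPosition M N u w C D r r' f g (q + 1) E S T) (a : A) :
    ∃ b, JoinPosition M N u w C D r r' f g q (insertPair E a b) S T := by
  obtain ⟨j, hj, hj', hc⟩ := h.comp
  obtain ⟨j, rfl⟩ : ∃ k, j = k + 1 := ⟨j - 1, by omega⟩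
  obtain rfl | ⟨i, x, rfl⟩ := hM.cover a
  · refine ⟨w, ⟨⟨j + 1, by omega, fun _ => hj, fun i => (hc i).mono ?_ (fun _ _ => id)
      (fun _ _ => id)⟩, ?_, h.set, h.rel⟩⟩
    · rintro x y (h | ⟨h, -⟩)
      · exact h
      · exact absurd h (hM.ne _ _)
    · rintro x y (h' | h')
      · exact h.elt x y h'
      · exact Or.inl h'
  · obtain ⟨y, hy⟩ := (hc i).2.1.1 x
    refine ⟨g i y, ⟨⟨j, by omega, ?_, fun i' => ?_⟩, ?_, h.set, h.rel⟩⟩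
    -- If the fresh root was played earlier, the spare round persists: the number of rounds in the
    -- components and the overall number both drop by one.
    · rintro (h | ⟨h, -⟩)
      · have := hj' h
        omega
      · exact absurd h.symm (hM.ne _ _)
    · by_cases hi : i = i'
      · subst hi
        refine hy.mono ?_ (fun _ _ => id) (fun _ _ => id)
        rintro x' y' (h | ⟨h, h'⟩)
        · exact Or.inl h
        · exact Or.inr ⟨hM.inj i h, hN.inj i h'⟩
      · refine (hc i').of_succ.mono ?_ (fun _ _ => id) (fun _ _ => id)
        rintro x' y' (h | ⟨h, -⟩)
        · exact h
        · exact absurd (hM.disj h).symm hi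
    · rintro x' y' (h' | ⟨rfl, rfl⟩)
      · exact h.elt x' y' h'
      · exact Or.inr ⟨i, x, y, rfl, rfl⟩

/-- The answer is glued from the components' answers, and membership of the fresh root is copied. -/
theorem JoinPosition.exists_set (hN : IsJoin N w D r' g)
    (h : JoinPosition M N u w C D r r' f g (q + 1) E S T) (P : A → Prop) :
    ∃ P', JoinPosition M N u w C D r r' f g q E (insertPair S P P') T := by
  obtain ⟨j, hj, hj', hc⟩ := h.comp
  obtain ⟨j, rfl⟩ : ∃ k, j = k + 1 := ⟨j - 1, by omega⟩
  choose p hp using fun i => (hc i).2.2.1.1 fun x => P (f i x)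
  set P' : B → Prop := fun y => (y = w ∧ P u) ∨ ∃ i b, y = g i b ∧ p i b
  have hg : ∀ i b, P' (g i b) ↔ p i b := by
    intro i b
    constructor
    · rintro (⟨h, -⟩ | ⟨i', b', h, h'⟩)
      · exact absurd h (hN.ne _ _)
      · obtain rfl := hN.disj h
        rwa [hN.inj i h]
    · exact fun h => Or.inr ⟨i, b, rfl, h⟩
  have hw : P u ↔ P' w := by
    constructor
    · exact fun h => Or.inl ⟨rfl, h⟩
    · rintro (⟨-, h⟩ | ⟨i, b, h, -⟩)
      · exact h
      · exact absurd h.symm (hN.ne _ _)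
  refine ⟨P', ⟨⟨j, by omega, fun h => by have := hj' h; omega, fun i => (hp i).mono
    (fun _ _ => id) ?_ (fun _ _ => id)⟩, h.elt, ?_, h.rel⟩⟩
  · rintro a b ⟨P1, P1', h | ⟨rfl, rfl⟩, h1, h2⟩
    · exact Or.inl ⟨P1, P1', h, h1, h2⟩
    · exact Or.inr ⟨funext fun x => propext (h1 x), funext fun x => propext ((h2 x).trans (hg i x))⟩
  · rintro P1 P1' (h' | ⟨rfl, rfl⟩)
    · exact h.set _ _ h'
    · exact hw

/-- A set of edges contains no pairs between different components. It splits into one part per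
component, answered there, and the edges from the fresh root to component roots, which are copied.
This is where the restriction of relation variables to subsets of `s` is needed. -/
theorem JoinPosition.exists_rel (hM : IsJoin M u C r f) (hN : IsJoin N w D r' g)
    (h : JoinPosition M N u w C D r r' f g (q + 1) E S T) (Q : A → A → Prop) (hQ : M.SubEdge Q) :
    ∃ Q', N.SubEdge Q' ∧ JoinPosition M N u w C D r r' f g q E S (insertPair T Q Q') := by
  obtain ⟨j, hj, hj', hc⟩ := h.comp
  obtain ⟨j, rfl⟩ : ∃ k, j = k + 1 := ⟨j - 1, by omega⟩
  choose p hp' hp using fun i => (hc i).2.2.2.1 (fun x y => Q (f i x) (f i y))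
    (fun x y h => (hM.edge i x y).1 (hQ _ _ h))
  set Q' : B → B → Prop := fun y y' => (y = w ∧ ∃ i, y' = g i (r' i) ∧ Q u (f i (r i))) ∨
    ∃ i b b', y = g i b ∧ y' = g i b' ∧ p i b b'
  have hg : ∀ i b b', Q' (g i b) (g i b') ↔ p i b b' := by
    intro i b b'
    constructor
    · rintro (⟨h, -⟩ | ⟨i', c, c', h, h', h''⟩)
      · exact absurd h (hN.ne _ _)
      · obtain rfl := hN.disj h
        rwa [hN.inj i h, hN.inj i h']
    · exact fun h => Or.inr ⟨i, b, b', rfl, rfl, h⟩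
  have hw : ∀ i, Q u (f i (r i)) ↔ Q' w (g i (r' i)) := by
    intro i
    constructor
    · exact fun h => Or.inl ⟨rfl, i, rfl, h⟩
    · rintro (⟨-, i', h, h'⟩ | ⟨i, b, b', h, -⟩)
      · obtain rfl := hN.disj h
        exact h'
      · exact absurd h.symm (hN.ne _ _)
  have hs : N.SubEdge Q' := by
    rintro y y' (⟨rfl, i, rfl, -⟩ | ⟨i, b, b', rfl, rfl, h⟩)
    · exact (hN.edge_root _ _).2 rfl
    · exact (hN.edge _ _ _).2 (hp' _ _ _ h)
  refine ⟨Q', hs, ⟨⟨j, by omega, fun h => by have := hj' h; omega, fun i => (hp i).mono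
    (fun _ _ => id) (fun _ _ => id) ?_⟩, h.elt, h.set, ?_⟩⟩
  · rintro a b ⟨P1, P1', h | ⟨rfl, rfl⟩, h1, h2⟩
    · exact Or.inl ⟨P1, P1', h, h1, h2⟩
    · exact Or.inr ⟨funext₂ fun x y => propext (h1 x y),
        funext₂ fun x y => propext ((h2 x y).trans (hg i x y))⟩
  · rintro Q1 Q1' (h' | ⟨rfl, rfl⟩)
    · exact h.rel _ _ h'
    · exact ⟨hQ, hs, hw⟩

theorem JoinPosition.bf (hM : IsJoin M u C r f) (hN : IsJoin N w D r' g)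
    (hU : ∀ l, M.U l u ↔ N.U l w) (h : JoinPosition M N u w C D r r' f g q E S T) :
    BF M N q E S T := by
  induction q generalizing E S T with
  | zero => exact h.atomic hM hN hU
  | succ q ih =>
    have i {γ δ : Type} {R : γ → δ → Prop} (a : γ) (b : δ) (x : γ) (y : δ) :
      insertPair R a b x y → flip (insertPair (flip R) b a) x y := (insertPair_flip a b x y).2
    refine ⟨h.atomic hM hN hU, ⟨fun a => ?_, fun b => ?_⟩, ⟨fun P => ?_, fun P => ?_⟩,
      fun Q hQ => ?_, fun Q hQ => ?_⟩
    · exact (h.exists_elt hM hN a).imp fun _ => ih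
    · exact (h.symm.exists_elt hN hM b).imp fun a h =>
        ih (h.symm.mono (i a b) (fun _ _ => id) (fun _ _ => id))
    · exact (h.exists_set hN P).imp fun _ => ih
    · exact (h.symm.exists_set hM P).imp fun P' h =>
        ih (h.symm.mono (fun _ _ => id) (i P' P) (fun _ _ => id))
    · exact (h.exists_rel hM hN Q hQ).imp fun _ h => ⟨h.1, ih h.2⟩
    · exact (h.symm.exists_rel hN hM Q hQ).imp fun Q' h =>
        ⟨h.1, ih (h.2.symm.mono (fun _ _ => id) (fun _ _ => id) (i Q' Q))⟩

/-- Joins of equivalent components with equally labelled roots are equivalent. -/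
theorem IsJoin.equivRank (hM : IsJoin M u C r f) (hN : IsJoin N w D r' g)
    (hU : ∀ l, M.U l u ↔ N.U l w) (h : ∀ i, (C i).EquivRank q (D i)) : M.EquivRank q N :=
  JoinPosition.bf hM hN hU
    -- The fresh root has not been played in the initial position, so no spare round is owed.
    { comp := ⟨q, le_rfl, False.elim, fun i => (h i).mono (fun _ _ => id)
        (fun _ _ ⟨_, _, h, _⟩ => h) (fun _ _ ⟨_, _, h, _⟩ => h)⟩
      elt := fun _ _ => False.elim
      set := fun _ _ => False.elim
      rel := fun _ _ => False.elim }

end Join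

/-! ### Model checking on codes -/

/-- The list of all sublists of a list. -/
def subs {α : Type} (L : List α) : List (List α) :=
  L.foldr (fun a acc => acc ++ acc.map (List.cons a)) [[]]

theorem filter_mem_subs {α : Type} (p : α → Bool) (L : List α) : L.filter p ∈ subs L := by
  induction L with
  | nil => simp [subs]
  | cons a L ih =>
    simp only [subs, List.foldr_cons, List.mem_append, List.mem_map] at ih ⊢
    by_cases h : p a
    · exact Or.inr ⟨_, ih, by simp [h]⟩
    · exact Or.inl (by simpa [h] using ih)

theorem subset_of_mem_subs {α : Type} {l L : List α} (h : l ∈ subs L) : l ⊆ L := by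
  induction L generalizing l with
  | nil => simp_all [subs]
  | cons a L ih =>
    simp only [subs, List.foldr_cons, List.mem_append, List.mem_map] at ih h
    obtain h | ⟨l', h, rfl⟩ := h
    · exact List.Subset.trans (ih h) (List.subset_cons_self a L)
    · exact List.cons_subset_cons a (ih h)

/-- Finite data for a structure: the list of elements, the list of edges, and the list of pairs of a
label and an element that carries it. -/
abbrev StrData : Type := List ℕ × List (ℕ × ℕ) × List (ℕ × ℕ)

/-- The structure described by finite data. -/
def StrData.str (n : ℕ) (d : StrData) : Str n {x // x ∈ d.1} where
  s a b := (a.1, b.1) ∈ d.2.1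
  U i a := (i.1, a.1) ∈ d.2.2

/-- Assignments of finitely many element, set and relation variables, as association lists. -/
abbrev Env : Type := List (ℕ × ℕ) × List (ℕ × List ℕ) × List (ℕ × List (ℕ × ℕ))

/-- The value of a variable in an association list. -/
def valD {α : Type} [Inhabited α] (l : List (ℕ × α)) (x : ℕ) : α := (l.lookup x).getD default

theorem valD_cons {α : Type} [Inhabited α] (l : List (ℕ × α)) (y : ℕ) (a : α) (x : ℕ) :
    valD ((y, a) :: l) x = if x = y then a else valD l x := by
  by_cases h : x = y
  · simp [valD, h]
  · have : (x == y) = false := by simpa using h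
    simp [valD, List.lookup_cons, this, h]

/-- The pairs of a subformula and an assignment on which the truth value of a formula under an
assignment depends. -/
def evalSub (d : StrData) (b : ℕ × Env) : List (ℕ × Env) :=
  let t := b.1.unpair.1
  let r := b.1.unpair.2
  if t = 6 then [(r, b.2)]
  else if t = 7 ∨ t = 8 then [(r.unpair.1, b.2), (r.unpair.2, b.2)]
  else if t = 9 ∨ t = 10 then
    d.1.map fun a => (r.unpair.2, (r.unpair.1, a) :: b.2.1, b.2.2)
  else if t = 11 ∨ t = 12 then
    (subs d.1).map fun a => (r.unpair.2, b.2.1, (r.unpair.1, a) :: b.2.2.1, b.2.2.2)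
  else if t = 13 ∨ t = 14 then
    (subs d.2.1).map fun a => (r.unpair.2, b.2.1, b.2.2.1, (r.unpair.1, a) :: b.2.2.2)
  else []

/-- The truth value of a formula under an assignment, from the list of truth values for `evalSub`. -/
def evalStep (d : StrData) (b : ℕ × Env) (l : List Bool) : Bool :=
  let t := b.1.unpair.1
  let r := b.1.unpair.2
  if t = 1 then decide (valD b.2.1 r.unpair.1 = valD b.2.1 r.unpair.2)
  else if t = 2 then decide ((r.unpair.1, valD b.2.1 r.unpair.2) ∈ d.2.2)
  else if t = 3 then decide ((valD b.2.1 r.unpair.1, valD b.2.1 r.unpair.2) ∈ d.2.1)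
  else if t = 4 then decide (valD b.2.1 r.unpair.2 ∈ valD b.2.2.1 r.unpair.1)
  else if t = 5 then decide ((valD b.2.1 r.unpair.2.unpair.1, valD b.2.1 r.unpair.2.unpair.2) ∈
    valD b.2.2.2 r.unpair.1)
  else if t = 6 ∨ t = 7 ∨ t = 10 ∨ t = 12 ∨ t = 14 then
    decide (if t = 6 then true ∉ l else false ∉ l)
  -- This covers disjunctions and existential quantifiers, and also `⊥`: its list of subvalues is
  -- empty, so the result is `false`.
  else decide (true ∈ l)

theorem snd_unpair_lt {c : ℕ} (h : c.unpair.1 ≠ 0) : c.unpair.2 < c := by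
  have := Nat.add_le_pair c.unpair.1 c.unpair.2
  rw [Nat.pair_unpair] at this
  omega

/-- Codes of subformulas are smaller, which gives both the termination of `evalC` and its primitive
recursiveness. -/
theorem evalSub_lt (d : StrData) (b : ℕ × Env) : ∀ b' ∈ evalSub d b, b'.1 < b.1 := by
  intro b' hb'
  have h0 : b.1.unpair.1 ≠ 0 → b.1.unpair.2 < b.1 := snd_unpair_lt
  have h1 := Nat.unpair_left_le b.1.unpair.2
  have h2 := Nat.unpair_right_le b.1.unpair.2
  unfold evalSub at hb'
  dsimp only at hb'
  split_ifs at hb'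
  · simp only [List.mem_singleton] at hb'
    subst hb'
    exact h0 (by omega)
  · have := h0 (by omega)
    simp only [List.mem_cons, List.not_mem_nil, or_false] at hb'
    obtain rfl | rfl := hb' <;> dsimp only <;> omega
  all_goals first
    | (simp only [List.mem_map] at hb'
       have := h0 (by omega)
       obtain ⟨a, -, rfl⟩ := hb'
       dsimp only
       omega)
    | simp at hb'

/-- The truth value of the formula with a given code under a given assignment. -/
def evalC (d : StrData) (b : ℕ × Env) : Bool :=
  evalStep d b ((evalSub d b).attach.map fun b' => evalC d b'.1)
termination_by b.1
decreasing_by exact evalSub_lt d b b'.1 b'.2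

theorem evalC_eq (d : StrData) (b : ℕ × Env) :
    evalC d b = evalStep d b ((evalSub d b).map (evalC d)) := by
  rw [evalC, List.attach_map_val (f := evalC d)]

/-- The association lists `env` represent the assignments `e`, `S`, `T`. -/
structure Env.Represents {d : StrData} (env : Env) (e : ℕ → {x // x ∈ d.1})
    (S : ℕ → {x // x ∈ d.1} → Prop) (T : ℕ → {x // x ∈ d.1} → {x // x ∈ d.1} → Prop) : Prop where
  elt : ∀ x, valD env.1 x = (e x).1
  set : ∀ X a, S X a ↔ a.1 ∈ valD env.2.1 X
  rel : ∀ R a b, T R a b ↔ (a.1, b.1) ∈ valD env.2.2 R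

section

variable {d : StrData} {env : Env} {e : ℕ → {x // x ∈ d.1}}
  {S : ℕ → {x // x ∈ d.1} → Prop} {T : ℕ → {x // x ∈ d.1} → {x // x ∈ d.1} → Prop}

theorem Env.Represents.updateElt (h : env.Represents e S T) (x : ℕ) (a : {x // x ∈ d.1}) :
    Env.Represents ((x, a.1) :: env.1, env.2) (Function.update e x a) S T where
  elt y := by
    by_cases hy : y = x
    · subst hy; simp [valD_cons]
    · simp [valD_cons, hy, h.elt]
  set := h.set
  rel := h.rel

theorem Env.Represents.updateSet (h : env.Represents e S T) (X : ℕ) {P : {x // x ∈ d.1} → Prop}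
    {l : List ℕ} (hP : ∀ a, P a ↔ a.1 ∈ l) :
    Env.Represents (env.1, (X, l) :: env.2.1, env.2.2) e (Function.update S X P) T where
  elt := h.elt
  set y := by
    by_cases hy : y = X
    · subst hy; simpa [valD_cons] using hP
    · simpa [valD_cons, hy] using h.set y
  rel := h.rel

theorem Env.Represents.updateRel (h : env.Represents e S T) (R : ℕ)
    {Q : {x // x ∈ d.1} → {x // x ∈ d.1} → Prop}
    {l : List (ℕ × ℕ)} (hQ : ∀ a b, Q a b ↔ (a.1, b.1) ∈ l) :
    Env.Represents (env.1, env.2.1, (R, l) :: env.2.2) e S (Function.update T R Q) where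
  elt := h.elt
  set := h.set
  rel y := by
    by_cases hy : y = R
    · subst hy; simpa [valD_cons] using hQ
    · simpa [valD_cons, hy] using h.rel y

theorem exists_mem_subs_iff (P : {x // x ∈ d.1} → Prop) :
    ∃ l ∈ subs d.1, ∀ a, P a ↔ a.1 ∈ l := by
  classical
  refine ⟨_, filter_mem_subs (fun x => decide (∃ h : x ∈ d.1, P ⟨x, h⟩)) d.1, fun a => ?_⟩
  simp [a.2]

/-- Since relation variables range over sets of edges, sublists of the edge list are enough to
represent all their values. -/
theorem exists_mem_subs_edges_iff {n : ℕ} (Q : {x // x ∈ d.1} → {x // x ∈ d.1} → Prop)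
    (hQ : ∀ a b, Q a b → (d.str n).s a b) :
    ∃ l ∈ subs d.2.1, ∀ a b, Q a b ↔ (a.1, b.1) ∈ l := by
  classical
  refine ⟨_, filter_mem_subs (fun x => decide (∃ (h : x.1 ∈ d.1) (h' : x.2 ∈ d.1),
    Q ⟨x.1, h⟩ ⟨x.2, h'⟩)) d.2.1, fun a b => ?_⟩
  simp only [List.mem_filter, decide_eq_true_eq, a.2, b.2, exists_true_left]
  exact ⟨fun h => ⟨hQ _ _ h, h⟩, fun h => h.2⟩

theorem evalC_code_iff {n : ℕ} (φ : MSO n) (h : env.Represents e S T) :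
    evalC d (φ.code, env) = true ↔ φ.Sat (d.str n) e S T := by
  induction φ generalizing env e S T with
  | bot => rw [evalC_eq]; simp [evalStep, evalSub, MSO.code, MSO.Sat]
  | eq x y => rw [evalC_eq]; simp [evalStep, MSO.code, MSO.Sat, h.elt, Subtype.ext_iff]
  | un i x => rw [evalC_eq]; simp [evalStep, MSO.code, MSO.Sat, h.elt, StrData.str]
  | edge x y => rw [evalC_eq]; simp [evalStep, MSO.code, MSO.Sat, h.elt, StrData.str]
  | mem X x => rw [evalC_eq]; simp [evalStep, MSO.code, MSO.Sat, h.elt, h.set]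
  | rel R x y => rw [evalC_eq]; simp [evalStep, MSO.code, MSO.Sat, h.elt, h.rel]
  | neg φ ih => rw [evalC_eq]; simp [evalStep, evalSub, MSO.code, MSO.Sat, ← ih h]
  | and φ ψ ih1 ih2 =>
    rw [evalC_eq]; simp [evalStep, evalSub, MSO.code, MSO.Sat, ← ih1 h, ← ih2 h]
  | or φ ψ ih1 ih2 =>
    rw [evalC_eq]; simp [evalStep, evalSub, MSO.code, MSO.Sat, ← ih1 h, ← ih2 h]
  | exElt x φ ih =>
    rw [evalC_eq]; simp [evalStep, evalSub, MSO.code, MSO.Sat, ← ih (h.updateElt x _)]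
  | allElt x φ ih =>
    rw [evalC_eq]; simp [evalStep, evalSub, MSO.code, MSO.Sat, ← ih (h.updateElt x _)]
  | exSet x φ ih =>
    rw [evalC_eq]
    simp [evalStep, evalSub, MSO.code, -Subtype.forall, -Subtype.exists]
    constructor
    · rintro ⟨l, hl, hl'⟩
      exact ⟨fun a => a.1 ∈ l, (ih (h.updateSet x fun _ => Iff.rfl)).1 hl'⟩
    · rintro ⟨P, hP⟩
      obtain ⟨l, hl, hl'⟩ := exists_mem_subs_iff P
      exact ⟨l, hl, (ih (h.updateSet x hl')).2 hP⟩
  | allSet x φ ih =>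
    rw [evalC_eq]
    simp [evalStep, evalSub, MSO.code, -Subtype.forall, -Subtype.exists]
    constructor
    · rintro H P
      obtain ⟨l, hl, hl'⟩ := exists_mem_subs_iff P
      exact (ih (h.updateSet x hl')).1 (H l hl)
    · rintro H l hl
      exact (ih (h.updateSet x fun _ => Iff.rfl)).2 (H fun a => a.1 ∈ l)
  | exRel x φ ih =>
    rw [evalC_eq]
    simp [evalStep, evalSub, MSO.code, -Subtype.forall, -Subtype.exists]
    constructor
    · rintro ⟨l, hl, hl'⟩
      exact ⟨fun a b => (a.1, b.1) ∈ l, fun a b hab => subset_of_mem_subs hl hab,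
        (ih (h.updateRel x fun _ _ => Iff.rfl)).1 hl'⟩
    · rintro ⟨Q, hQ', hQ⟩
      obtain ⟨l, hl, hl'⟩ := exists_mem_subs_edges_iff Q hQ'
      exact ⟨l, hl, (ih (h.updateRel x hl')).2 hQ⟩
  | allRel x φ ih =>
    rw [evalC_eq]
    simp [evalStep, evalSub, MSO.code, -Subtype.forall, -Subtype.exists]
    constructor
    · rintro H Q hQ
      obtain ⟨l, hl, hl'⟩ := exists_mem_subs_edges_iff Q hQ
      exact (ih (h.updateRel x hl')).1 (H l hl)
    · rintro H l hl
      exact (ih (h.updateRel x fun _ _ => Iff.rfl)).2 (H (fun a b => (a.1, b.1) ∈ l)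
        fun a b hab => subset_of_mem_subs hl hab)

end

/-- Does the structure described by `d` satisfy the sentence with code `c`? -/
def modelsC (d : StrData) (c : ℕ) : Bool := evalC d (c, [], [], [])

/-- In the empty environment every element variable takes the default value `0`, hence `0` has to be
an element. Set and relation variables default to the empty list. -/
theorem modelsC_code_iff {n : ℕ} {d : StrData} (h0 : 0 ∈ d.1) {φ : MSO n} (hφ : φ.IsSentence) :
    modelsC d φ.code = true ↔ (d.str n).Models φ := by
  rw [hφ.models_iff_sat _ (fun _ => ⟨0, h0⟩) (fun _ _ => False) (fun _ _ _ => False)]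
  exact evalC_code_iff φ ⟨fun _ => rfl, fun _ _ => iff_of_false id List.not_mem_nil,
    fun _ _ _ => iff_of_false id List.not_mem_nil⟩

/-! ### Data for trees -/

/-- The number `0` is an element of the structure described by `d`, and the only one without
predecessors. -/
def StrData.Rooted (d : StrData) : Prop :=
  0 ∈ d.1 ∧ ∀ x ∈ d.1, x = 0 ↔ ∀ y ∈ d.1, (y, x) ∉ d.2.1

theorem StrData.Rooted.isRoot {d : StrData} (h : d.Rooted) (n : ℕ) :
    (d.str n).IsRoot ⟨0, h.1⟩ := by
  intro x
  rw [Subtype.ext_iff, h.2 x.1 x.2]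
  simp [StrData.str]

/-- The element `x` of the `i`-th child, as an element of the compound tree. -/
def childElt (i x : ℕ) : ℕ := Nat.pair i x + 1

theorem childElt_inj {i x j y : ℕ} : childElt i x = childElt j y ↔ i = j ∧ x = y := by
  simp [childElt, Nat.pair_eq_pair]

theorem childElt_ne_zero {i x : ℕ} : childElt i x ≠ 0 := Nat.succ_ne_zero _

/-- Data for the tree whose root has the labels `τ` and the children `ks`. -/
def StrData.node (τ : List ℕ) (ks : List StrData) : StrData :=
  (0 :: (List.range ks.length).flatMap fun i => (ks.getD i default).1.map (childElt i),
    (List.range ks.length).flatMap fun i => (0, childElt i 0) ::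
      (ks.getD i default).2.1.map fun e => (childElt i e.1, childElt i e.2),
    τ.map (fun l => (l, 0)) ++ (List.range ks.length).flatMap fun i =>
      (ks.getD i default).2.2.map fun e => (e.1, childElt i e.2))

namespace StrData

variable {τ : List ℕ} {ks : List StrData}

theorem zero_mem_node : 0 ∈ (node τ ks).1 := by simp [node]

theorem childElt_mem_node {i x : ℕ} :
    childElt i x ∈ (node τ ks).1 ↔ i < ks.length ∧ x ∈ (ks.getD i default).1 := by
  simp only [node, List.mem_cons, childElt_ne_zero, List.mem_flatMap, List.mem_range, List.mem_map,
    childElt_inj, false_or]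
  grind

theorem edge_node {i x j y : ℕ} : (childElt i x, childElt j y) ∈ (node τ ks).2.1 ↔
    i = j ∧ i < ks.length ∧ (x, y) ∈ (ks.getD i default).2.1 := by
  simp only [node, List.mem_flatMap, List.mem_range, List.mem_cons, Prod.mk.injEq, childElt_ne_zero,
    List.mem_map, childElt_inj, false_and, false_or, Prod.exists]
  grind

theorem edge_root_node {i x : ℕ} : (0, childElt i x) ∈ (node τ ks).2.1 ↔
    i < ks.length ∧ x = 0 := by
  simp only [node, List.mem_flatMap, List.mem_range, List.mem_cons, Prod.mk.injEq,
    childElt_ne_zero, List.mem_map, childElt_inj, false_and, and_false, exists_false, or_false,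
    true_and]
  grind

theorem edge_to_root_node {x : ℕ} : (x, 0) ∉ (node τ ks).2.1 := by
  simp [node, childElt_ne_zero, childElt_ne_zero.symm]

theorem label_node {l i x : ℕ} : (l, childElt i x) ∈ (node τ ks).2.2 ↔
    i < ks.length ∧ (l, x) ∈ (ks.getD i default).2.2 := by
  simp only [node, List.mem_append, List.mem_flatMap, List.mem_range, Prod.mk.injEq,
    childElt_ne_zero.symm, List.mem_map, childElt_inj, and_false, exists_false, false_or,
    Prod.exists]
  grind

theorem label_root_node {l : ℕ} : (l, 0) ∈ (node τ ks).2.2 ↔ l ∈ τ := by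
  simp [node, childElt_ne_zero]

theorem mem_node_cases {x : ℕ} (h : x ∈ (node τ ks).1) :
    x = 0 ∨ ∃ i a, i < ks.length ∧ a ∈ (ks.getD i default).1 ∧ x = childElt i a := by
  simp only [node, List.mem_cons, List.mem_flatMap, List.mem_range, List.mem_map] at h
  grind

theorem getD_mem {i : ℕ} (hi : i < ks.length) : ks.getD i default ∈ ks := by
  simp [List.getD_eq_getElem?_getD, hi]

theorem rooted_node (h : ∀ k ∈ ks, Rooted k) : (node τ ks).Rooted := by
  refine ⟨zero_mem_node, fun x hx => ⟨?_, fun H => ?_⟩⟩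
  · rintro rfl y -
    exact edge_to_root_node
  · obtain rfl | ⟨i, a, hi, ha, rfl⟩ := mem_node_cases hx
    · rfl
    have hk := h _ (getD_mem hi)
    by_cases h0 : a = 0
    · exact absurd (edge_root_node.2 ⟨hi, h0⟩) (H 0 zero_mem_node)
    · rw [hk.2 a ha] at h0
      push Not at h0
      obtain ⟨y, hy, hy'⟩ := h0
      exact absurd (edge_node.2 ⟨rfl, hi, hy'⟩) (H _ (childElt_mem_node.2 ⟨hi, hy⟩))

/-- Keeping `m` apart from `ks.length` lets two joins whose lists of children have provably equal
lengths share one index type, as `IsJoin.equivRank` requires. -/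
theorem isJoin_node (n : ℕ) (h : ∀ k ∈ ks, Rooted k) {m : ℕ} (hm : m = ks.length) :
    IsJoin ((node τ ks).str n) ⟨0, zero_mem_node⟩ (fun i : Fin m => (ks.getD i default).str n)
      (fun i => ⟨0, (h _ (getD_mem (hm ▸ i.2))).1⟩)
      (fun i x => ⟨childElt i x, childElt_mem_node.2 ⟨hm ▸ i.2, x.2⟩⟩) := by
  have hlt : ∀ i : Fin m, i.1 < ks.length := fun i => hm ▸ i.2
  constructor
  · intro i x y h
    simpa [childElt_inj, Subtype.ext_iff] using h
  · intro i j x y h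
    simp only [Subtype.mk.injEq, childElt_inj] at h
    exact Fin.ext h.1
  · intro i x h
    exact childElt_ne_zero (congrArg Subtype.val h)
  · rintro ⟨x, hx⟩
    obtain rfl | ⟨i, a, hi, ha, rfl⟩ := mem_node_cases hx
    · exact Or.inl rfl
    · exact Or.inr ⟨⟨i, hm ▸ hi⟩, ⟨a, ha⟩, rfl⟩
  · intro i x y
    exact edge_node.trans (by simp [hlt i, str])
  · intro i j x y h
    exact Fin.ext (edge_node.1 h).1
  · intro i x
    exact edge_root_node.trans (by simp [hlt i, Subtype.ext_iff])
  · rintro ⟨x, hx⟩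
    exact edge_to_root_node
  · intro l i x
    exact label_node.trans (by simp [hlt i, str])
  · exact fun i => (h _ (getD_mem (hlt i))).isRoot n

end StrData

/-! ### Subtrees -/

section Tree

variable {n : ℕ} {A : Type} {M : Str n A}

theorem IsBinaryTree.parent_unique {s : A → A → Prop} (h : IsBinaryTree s) {x y z : A}
    (hx : s x z) (hy : s y z) : x = y := by
  obtain ⟨-, ⟨r, hr, h⟩, -⟩ := h
  exact (h z (fun hz => hr x (hz ▸ hx))).unique hx hy

/-- Parents are unique, so the ancestors of `x` form a chain and the two siblings are comparable. A
non-trivial path from one to the other would enter its end through the common parent `u` and close a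
cycle. -/
theorem IsBinaryTree.eq_of_reach {s : A → A → Prop} (h : IsBinaryTree s) {u v w x : A}
    (hv : s u v) (hw : s u w) (hvx : Relation.ReflTransGen s v x)
    (hwx : Relation.ReflTransGen s w x) : v = w := by
  have key : ∀ {v w}, s u v → s u w → Relation.ReflTransGen s v w → v = w := by
    intro v w hv hw hvw
    obtain rfl | ⟨p, hp, hpw⟩ := hvw.cases_tail
    · rfl
    · obtain rfl := h.parent_unique hpw hw
      exact absurd (Relation.TransGen.head' hv hp) (h.1 p)
  obtain h1 | h1 := Relation.ReflTransGen.total_of_right_unique (r := Function.swap s)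
    (fun a b c hab hac => h.parent_unique hab hac) (Relation.reflTransGen_swap.2 hvx)
    (Relation.reflTransGen_swap.2 hwx)
  · exact (key hw hv (Relation.reflTransGen_swap.1 h1)).symm
  · exact key hv hw (Relation.reflTransGen_swap.1 h1)

/-- The first half serves inductions from the root downwards, the second those from the leaves
upwards. -/
theorem IsBinaryTree.wellFounded [Finite A] {s : A → A → Prop} (h : IsBinaryTree s) :
    WellFounded s ∧ WellFounded (Function.swap s) := by
  have : Std.Irrefl (Relation.TransGen s) := ⟨h.1⟩
  have : Std.Irrefl (Function.swap (Relation.TransGen s)) := ⟨h.1⟩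
  have : IsTrans A (Function.swap (Relation.TransGen s)) := ⟨fun a b c h1 h2 => h2.trans h1⟩
  constructor
  · exact Subrelation.wf (fun h => Relation.TransGen.single h)
      (Finite.wellFounded_of_trans_of_irrefl (Relation.TransGen s))
  · exact Subrelation.wf (r := Function.swap (Relation.TransGen s))
      (fun h => Relation.TransGen.single h)
      (Finite.wellFounded_of_trans_of_irrefl (Function.swap (Relation.TransGen s)))

theorem IsBinaryTree.reach_of_root [Finite A] {s : A → A → Prop} (h : IsBinaryTree s) {r : A}
    (hr : ∀ y, ¬ s y r) (x : A) : Relation.ReflTransGen s r x := by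
  induction x using h.wellFounded.1.induction with
  | _ x ih =>
    obtain ⟨r', hr', hp⟩ := h.2.1
    have hrr : r = r' := by
      by_contra hne
      obtain ⟨y, hy, -⟩ := hp r hne
      exact hr y hy
    subst hrr
    by_cases hx : x = r
    · subst hx
      exact .refl
    · obtain ⟨y, hy, -⟩ := hp x hx
      exact (ih y hy).tail hy

instance (u : A) : Nonempty {v : A // Relation.ReflTransGen M.s u v} := ⟨⟨u, .refl⟩⟩

theorem Str.subtree_isRoot (hs : IsBinaryTree M.s) (u : A) : (M.subtree u).IsRoot ⟨u, .refl⟩ := by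
  rintro ⟨x, hx⟩
  constructor
  · intro h y hy
    obtain rfl : x = u := congrArg Subtype.val h
    exact hs.1 x (Relation.TransGen.tail' y.2 hy)
  · intro H
    obtain rfl | ⟨p, hp, hpx⟩ := hx.cases_tail
    · rfl
    · exact absurd hpx (H ⟨p, hp⟩)

/-- This brings the composition theorem to bear on trees; disjointness of the components is
`IsBinaryTree.eq_of_reach`. -/
theorem Str.isJoin_subtree (hs : IsBinaryTree M.s) {u : A} {cs : List A} (hn : cs.Nodup)
    (hc : ∀ y, y ∈ cs ↔ M.s u y) :
    IsJoin (M.subtree u) ⟨u, .refl⟩ (fun i : Fin cs.length => M.subtree (cs.get i))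
      (fun i => ⟨cs.get i, .refl⟩)
      (fun i x => ⟨x.1, .head ((hc _).1 (cs.get_mem i)) x.2⟩) := by
  have hci : ∀ i : Fin cs.length, M.s u (cs.get i) := fun i => (hc _).1 (cs.get_mem i)
  have hd : ∀ {i j : Fin cs.length} {x}, Relation.ReflTransGen M.s (cs.get i) x →
      Relation.ReflTransGen M.s (cs.get j) x → i = j :=
    fun h1 h2 => hn.injective_get (hs.eq_of_reach (hci _) (hci _) h1 h2)
  constructor
  · intro i x y h
    exact Subtype.ext (Subtype.mk.inj h)
  · rintro i j ⟨x, hx⟩ ⟨y, hy⟩ h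
    obtain rfl : x = y := congrArg Subtype.val h
    exact hd hx hy
  · rintro i ⟨x, hx⟩ h
    obtain rfl : x = u := congrArg Subtype.val h
    exact hs.1 x (Relation.TransGen.head' (hci i) hx)
  · rintro ⟨x, hx⟩
    obtain rfl | ⟨v, hv, hvx⟩ := hx.cases_head
    · exact Or.inl rfl
    · obtain ⟨i, rfl⟩ := List.mem_iff_get.1 ((hc v).2 hv)
      exact Or.inr ⟨i, ⟨x, hvx⟩, rfl⟩
  · exact fun _ _ _ => Iff.rfl
  · rintro i j ⟨x, hx⟩ ⟨y, hy⟩ h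
    exact hd (hx.tail h) hy
  · rintro i ⟨x, hx⟩
    constructor
    · intro h
      exact Subtype.ext (hs.eq_of_reach h (hci i) .refl hx)
    · intro h
      obtain rfl : x = cs.get i := congrArg Subtype.val h
      exact hci i
  · rintro ⟨x, hx⟩ h
    exact hs.1 u (Relation.TransGen.tail' hx h)
  · exact fun _ _ _ => Iff.rfl
  · exact fun i => M.subtree_isRoot hs _

/-- The list of children of a vertex. -/
theorem IsBinaryTree.exists_children [Finite A] {s : A → A → Prop} (h : IsBinaryTree s) (u : A) :
    ∃ cs : List A, cs.Nodup ∧ (∀ y, y ∈ cs ↔ s u y) ∧ cs.length ≤ 2 := by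
  classical
  have hf : {y | s u y}.Finite := Set.toFinite _
  refine ⟨hf.toFinset.toList, Finset.nodup_toList _, by simp, ?_⟩
  have := h.2.2 u
  rw [Set.Finite.encard_eq_coe_toFinset_card hf] at this
  rw [Finset.length_toList]
  exact_mod_cast this

theorem StrData.getD_eq_get {ks : List StrData} {i : ℕ} (hi : i < ks.length) :
    ks.getD i default = ks.get ⟨i, hi⟩ := by
  simp [List.getD_eq_getElem?_getD, hi]

/-- Composition between an actual subtree and a data tree: the children's subtrees may be replaced
by any equivalent data. -/
theorem Str.subtree_equivRank_node (hs : IsBinaryTree M.s) {q : ℕ} {u : A} {cs : List A}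
    (hn : cs.Nodup) (hc : ∀ y, y ∈ cs ↔ M.s u y) {τ : List ℕ} (hτ : ∀ i : Fin n, i.1 ∈ τ ↔ M.U i u)
    {ks : List StrData} (hk : List.Forall₂ (fun c (k : StrData) =>
      k.Rooted ∧ (M.subtree c).EquivRank q (k.str n)) cs ks) :
    (M.subtree u).EquivRank q ((StrData.node τ ks).str n) := by
  obtain ⟨hl, hk⟩ := List.forall₂_iff_get.1 hk
  have hr : ∀ k ∈ ks, k.Rooted := by
    intro k hk'
    obtain ⟨i, rfl⟩ := List.mem_iff_get.1 hk'
    exact (hk i (i.2.trans_eq hl.symm) i.2).1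
  refine (M.isJoin_subtree hs hn hc).equivRank (StrData.isJoin_node n hr hl)
    (fun l => (hτ l).symm.trans StrData.label_root_node.symm) fun i => ?_
  have := (hk i i.2 (i.2.trans_eq hl)).2
  rw [StrData.getD_eq_get (i.2.trans_eq hl)]
  exact this

/-- Composition between two data trees, used to exchange children for shallower ones. -/
theorem StrData.node_equivRank (n : ℕ) {q : ℕ} {τ : List ℕ} {ks ks' : List StrData}
    (hk : List.Forall₂ (fun (k k' : StrData) =>
      k.Rooted ∧ k'.Rooted ∧ (k.str n).EquivRank q (k'.str n)) ks ks') :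
    ((node τ ks).str n).EquivRank q ((node τ ks').str n) := by
  obtain ⟨hl, hk⟩ := List.forall₂_iff_get.1 hk
  have hr : ∀ k ∈ ks, k.Rooted := by
    intro k hk'
    obtain ⟨i, rfl⟩ := List.mem_iff_get.1 hk'
    exact (hk i i.2 (i.2.trans_eq hl)).1
  have hr' : ∀ k ∈ ks', k.Rooted := by
    intro k hk'
    obtain ⟨i, rfl⟩ := List.mem_iff_get.1 hk'
    exact (hk i (i.2.trans_eq hl.symm) i.2).2.1
  refine (isJoin_node n hr rfl).equivRank (isJoin_node n hr' hl)
    (fun l => label_root_node.trans label_root_node.symm) fun i => ?_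
  have := (hk i i.2 (i.2.trans_eq hl)).2.2
  rw [getD_eq_get i.2, getD_eq_get (i.2.trans_eq hl)]
  exact this

theorem Str.equivRank_subtree_root [Finite A] (hs : IsBinaryTree M.s) {r : A}
    (hr : ∀ y, ¬ M.s y r) (q : ℕ) : M.EquivRank q (M.subtree r) :=
  .of_equiv (Equiv.subtypeUnivEquiv (hs.reach_of_root hr)).symm (fun _ _ => Iff.rfl)
    (fun _ _ => Iff.rfl) q

end Tree

/-! ### Representatives of the Hintikka sentences that have tree models -/

/-- The lists of length at most two with entries from a given list. -/
def lists2 {α : Type} (L : List α) : List (List α) :=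
  [] :: (L.map (fun x => [x]) ++ L.flatMap fun x => L.map fun y => [x, y])

theorem mem_lists2 {α : Type} {L l : List α} : l ∈ lists2 L ↔ l.length ≤ 2 ∧ ∀ x ∈ l, x ∈ L := by
  match l with
  | [] => simp [lists2]
  | [x] => simp [lists2]
  | [x, y] => simp [lists2]
  | x :: y :: z :: l => simp [lists2]

/-- Data for all binary trees of height less than `k` with labels in `{0, …, n - 1}`. -/
def treeData (n : ℕ) : ℕ → List StrData
  | 0 => []
  | k + 1 => treeData n k ++ (subs (List.range n)).flatMap fun τ =>
      (lists2 (treeData n k)).map (StrData.node τ)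

/-- The first data tree that satisfies the `i`-th sentence of a list of sentences given by codes,
among the trees of height less than the length of that list. -/
def rep (n : ℕ) (H : List ℕ) (i : ℕ) : StrData :=
  ((treeData n H.length).filter fun d => modelsC d (H.getD i 0) = true).headI

theorem mem_treeData_succ {n k : ℕ} {d : StrData} : d ∈ treeData n (k + 1) ↔
    d ∈ treeData n k ∨ ∃ τ ∈ subs (List.range n), ∃ ks : List StrData, ks.length ≤ 2 ∧
      (∀ x ∈ ks, x ∈ treeData n k) ∧ d = StrData.node τ ks := by
  simp only [treeData, List.mem_append, List.mem_flatMap, List.mem_map, mem_lists2, and_assoc,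
    eq_comm]

theorem treeData_mono (n : ℕ) : Monotone fun k => {d | d ∈ treeData n k} :=
  monotone_nat_of_le_succ fun _ _ h => mem_treeData_succ.2 (Or.inl h)

theorem rooted_of_mem_treeData {n k : ℕ} {d : StrData} (h : d ∈ treeData n k) : d.Rooted := by
  induction k generalizing d with
  | zero => simp [treeData] at h
  | succ k ih =>
    obtain h | ⟨τ, -, ks, -, hks, rfl⟩ := mem_treeData_succ.1 h
    · exact ih h
    · exact StrData.rooted_node fun k hk => ih (hks k hk)

theorem exists_treeData_equivRank {n : ℕ} {A : Type} [Finite A] {M : Str n A}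
    (hs : IsBinaryTree M.s) (q : ℕ) (u : A) :
    ∃ k, ∃ d ∈ treeData n k, (M.subtree u).EquivRank q (d.str n) := by
  classical
  induction u using hs.wellFounded.2.induction with
  | _ u ih =>
    obtain ⟨cs, hn, hc, h2⟩ := hs.exists_children u
    -- The children come with different heights, so a common bound is collected along the list.
    have key : ∀ l : List A, (∀ y ∈ l, M.s u y) → ∃ k, ∃ ks : List StrData,
        (∀ x ∈ ks, x ∈ treeData n k) ∧ List.Forall₂ (fun c (k : StrData) =>
          k.Rooted ∧ (M.subtree c).EquivRank q (k.str n)) l ks := by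
      intro l
      induction l with
      | nil => exact fun _ => ⟨0, [], by simp, .nil⟩
      | cons y l ihl =>
        intro h
        rw [List.forall_mem_cons] at h
        obtain ⟨k, ks, h1, h2⟩ := ihl h.2
        obtain ⟨k', d, h3, h4⟩ := ih y h.1
        refine ⟨max k k', d :: ks, List.forall_mem_cons.2
          ⟨treeData_mono n (le_max_right _ _) h3, fun x hx =>
            treeData_mono n (le_max_left _ _) (h1 x hx)⟩,
          .cons ⟨rooted_of_mem_treeData h3, h4⟩ h2⟩
    obtain ⟨k, ks, h3, h4⟩ := key cs fun y => (hc y).1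
    refine ⟨k + 1, StrData.node ((List.range n).filter fun i =>
      decide (∃ h : i < n, M.U ⟨i, h⟩ u)) ks, mem_treeData_succ.2 (Or.inr
        ⟨_, filter_mem_subs _ _, ks, h4.length_eq ▸ h2, h3, rfl⟩),
      M.subtree_equivRank_node hs hn hc (fun i => ?_) h4⟩
    simp

/-! ### Stabilisation of the realized types and the choice of representatives -/

section Saturation

variable {n q : ℕ} {H : List (MSO n)}

theorem IsHintikkaSet.existsUnique_index (hH : IsHintikkaSet q H) {A : Type} [Finite A] [Nonempty A]
    (M : Str n A) : ∃! i : Fin H.length, M.Models (H.get i) := by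
  obtain ⟨ε, ⟨h1, h2⟩, h3⟩ := hH.existsUnique A M
  obtain ⟨i, rfl⟩ := List.mem_iff_get.1 h1
  exact ⟨i, h2, fun j hj => hH.nodup.injective_get (h3 _ ⟨H.get_mem j, hj⟩)⟩

theorem IsHintikkaSet.modelsC_iff (hH : IsHintikkaSet q H) {d : StrData} (hd : d.Rooted)
    (i : Fin H.length) : modelsC d (H.get i).code = true ↔ (d.str n).Models (H.get i) :=
  modelsC_code_iff hd.1 (hH.sentence _ (H.get_mem i)).1

theorem IsHintikkaSet.equivRank_of_modelsC (hH : IsHintikkaSet q H) {d d' : StrData}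
    (hd : d.Rooted) (hd' : d'.Rooted) {i : Fin H.length} (h : modelsC d (H.get i).code = true)
    (h' : modelsC d' (H.get i).code = true) : (d.str n).EquivRank q (d'.str n) := by
  have : Nonempty {x // x ∈ d.1} := ⟨0, hd.1⟩
  have : Nonempty {x // x ∈ d'.1} := ⟨0, hd'.1⟩
  exact hH.equivRank (H.get_mem i) ((hH.modelsC_iff hd i).1 h) ((hH.modelsC_iff hd' i).1 h')

/-- The `i`-th sentence has a model among the data trees of height less than `k`. -/
def Realized (H : List (MSO n)) (k : ℕ) (i : Fin H.length) : Prop :=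
  ∃ d ∈ treeData n k, modelsC d (H.get i).code = true

theorem Realized.mono {k k' : ℕ} (h : k ≤ k') {i : Fin H.length} (hi : Realized H k i) :
    Realized H k' i := by
  obtain ⟨d, h1, h2⟩ := hi
  exact ⟨d, treeData_mono n h h1, h2⟩

/-- A step that realizes nothing new is followed only by such steps. In a tree of the next stage
each child has a type already realized one stage earlier; exchanging the children accordingly keeps
the type of the whole tree by composition. -/
theorem IsHintikkaSet.realized_succ (hH : IsHintikkaSet q H) {k : ℕ}
    (h : ∀ i, Realized H (k + 1) i → Realized H k i) (i : Fin H.length)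
    (hi : Realized H (k + 2) i) : Realized H (k + 1) i := by
  obtain ⟨d, hd, hdi⟩ := hi
  obtain hd | ⟨τ, hτ, ks, h2, hks, rfl⟩ := mem_treeData_succ.1 hd
  · exact ⟨d, hd, hdi⟩
  have key : ∀ x ∈ ks, ∃ y ∈ treeData n k, x.Rooted ∧ y.Rooted ∧
      (x.str n).EquivRank q (y.str n) := by
    intro x hx
    have hxr := rooted_of_mem_treeData (hks x hx)
    have : Nonempty {a // a ∈ x.1} := ⟨0, hxr.1⟩
    obtain ⟨j, hj, -⟩ := hH.existsUnique_index (x.str n)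
    rw [← hH.modelsC_iff hxr] at hj
    obtain ⟨y, hy, hyj⟩ := h j ⟨x, hks x hx, hj⟩
    exact ⟨y, hy, hxr, rooted_of_mem_treeData hy,
      hH.equivRank_of_modelsC hxr (rooted_of_mem_treeData hy) hj hyj⟩
  obtain ⟨ks', h3, h4⟩ : ∃ ks' : List StrData, (∀ y ∈ ks', y ∈ treeData n k) ∧
      List.Forall₂ (fun (x y : StrData) => x.Rooted ∧ y.Rooted ∧
        (x.str n).EquivRank q (y.str n)) ks ks' := by
    clear h2 hks hd hdi
    induction ks with
    | nil => exact ⟨[], by simp, .nil⟩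
    | cons x ks ih =>
      rw [List.forall_mem_cons] at key
      obtain ⟨y, hy, hxy⟩ := key.1
      obtain ⟨ks', h3, h4⟩ := ih key.2
      exact ⟨y :: ks', List.forall_mem_cons.2 ⟨hy, h3⟩, .cons hxy h4⟩
  have hmem : StrData.node τ ks' ∈ treeData n (k + 1) :=
    mem_treeData_succ.2 (Or.inr ⟨τ, hτ, ks', h4.length_eq ▸ h2, h3, rfl⟩)
  have hr := rooted_of_mem_treeData hd
  have hr' := rooted_of_mem_treeData hmem
  have : Nonempty {x // x ∈ (StrData.node τ ks).1} := ⟨0, hr.1⟩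
  have : Nonempty {x // x ∈ (StrData.node τ ks').1} := ⟨0, hr'.1⟩
  have hs := hH.sentence _ (H.get_mem i)
  refine ⟨_, hmem, ?_⟩
  rw [hH.modelsC_iff hr']
  exact ((StrData.node_equivRank n h4).models_iff hs.1 hs.2).1 ((hH.modelsC_iff hr i).1 hdi)

/-- An increasing chain of subsets of `H` must stand still for one step at some stage `j ≤ |H|`, and
from there on it is constant. This justifies the search bound in `rep`. -/
theorem IsHintikkaSet.realized_length (hH : IsHintikkaSet q H) {k : ℕ} {i : Fin H.length}
    (hi : Realized H k i) : Realized H H.length i := by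
  classical
  have stable : ∀ {k}, (∀ i, Realized H (k + 1) i → Realized H k i) →
      ∀ l i, Realized H (k + l) i → Realized H k i := by
    intro k h l
    have h' : ∀ l i, Realized H (k + l + 1) i → Realized H (k + l) i := by
      intro l
      induction l with
      | zero => exact h
      | succ l ih => exact hH.realized_succ ih
    induction l with
    | zero => exact fun i hi => hi
    | succ l ih => exact fun i hi => ih i (h' l i hi)
  obtain ⟨j, hj, hst⟩ : ∃ j ≤ H.length, ∀ i, Realized H (j + 1) i → Realized H j i := by
    -- Otherwise each stage up to `|H|` adds a new sentence, so that `|H| + 1` members of `H` are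
    -- realized at stage `|H| + 1`.
    by_contra! hcon
    have hcard : ∀ j ≤ H.length + 1, j ≤ (Finset.univ.filter (Realized H j)).card := by
      intro j
      induction j with
      | zero => simp
      | succ j ih =>
        intro hj
        obtain ⟨i, h1, h2⟩ := hcon j (by omega)
        have : Finset.univ.filter (Realized H j) ⊂ Finset.univ.filter (Realized H (j + 1)) := by
          rw [Finset.ssubset_iff_of_subset (fun x hx => by
            simp only [Finset.mem_filter, Finset.mem_univ, true_and] at hx ⊢
            exact hx.mono (Nat.le_succ j))]
          exact ⟨i, by simpa using h1, by simpa using h2⟩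
        have := Finset.card_lt_card this
        have := ih (by omega)
        omega
    have h1 := hcard (H.length + 1) le_rfl
    have h2 := Finset.card_le_univ (Finset.univ.filter (Realized H (H.length + 1)))
    rw [Fintype.card_fin] at h2
    omega
  exact Realized.mono hj (stable hst k i (hi.mono (Nat.le_add_left k j)))

/-- The hypothesis makes the filtered list non-empty, so `headI` does not return its default. -/
theorem rep_spec {i : Fin H.length} (hi : Realized H H.length i) :
    (rep n (H.map MSO.code) i).Rooted ∧
      modelsC (rep n (H.map MSO.code) i) (H.get i).code = true := by
  obtain ⟨d, h1, h2⟩ := hi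
  have hget : (H.map MSO.code).getD i.1 0 = (H.get i).code := by
    simp [List.getD_eq_getElem?_getD]
  have hmem : rep n (H.map MSO.code) i ∈
      (treeData n H.length).filter fun d => modelsC d (H.get i).code = true := by
    unfold rep
    rw [hget, List.length_map]
    have hd : d ∈ (treeData n H.length).filter fun d => modelsC d (H.get i).code = true := by
      simpa using ⟨h1, h2⟩
    cases hL : (treeData n H.length).filter fun d => modelsC d (H.get i).code = true with
    | nil => rw [hL] at hd; simp at hd
    | cons x L => simp
  simp only [List.mem_filter, decide_eq_true_eq] at hmem
  exact ⟨rooted_of_mem_treeData hmem.1, hmem.2⟩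

/-- The representative of the Hintikka sentence of a subtree is equivalent to that subtree. -/
theorem IsHintikkaSet.subtree_equivRank_rep (hH : IsHintikkaSet q H) {A : Type} [Finite A]
    {M : Str n A} (hs : IsBinaryTree M.s) {u : A} {i : Fin H.length}
    (hi : (M.subtree u).Models (H.get i)) :
    (rep n (H.map MSO.code) i).Rooted ∧
      (M.subtree u).EquivRank q ((rep n (H.map MSO.code) i).str n) := by
  obtain ⟨k, d, hd, hdu⟩ := exists_treeData_equivRank hs q u
  have hr := rooted_of_mem_treeData hd
  have : Nonempty {x // x ∈ d.1} := ⟨0, hr.1⟩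
  have hsen := hH.sentence _ (H.get_mem i)
  obtain ⟨h1, h2⟩ := rep_spec (hH.realized_length (k := k) (i := i)
    ⟨d, hd, (hH.modelsC_iff hr i).2 ((hdu.models_iff hsen.1 hsen.2).1 hi)⟩)
  have : Nonempty {x // x ∈ (rep n (H.map MSO.code) i).1} := ⟨0, h1.1⟩
  exact ⟨h1, hH.equivRank (H.get_mem i) hi ((hH.modelsC_iff h1 i).1 h2)⟩

/-- The type of a subtree is computed from the labels of its root and the types of the children:
replace each child's subtree by the representative of its type and check the resulting data tree. -/
theorem IsHintikkaSet.modelsC_node_iff (hH : IsHintikkaSet q H) {A : Type} [Finite A]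
    {M : Str n A} (hs : IsBinaryTree M.s) {u : A} {cs : List A} (hn : cs.Nodup)
    (hc : ∀ y, y ∈ cs ↔ M.s u y) {τ : List ℕ} (hτ : ∀ i : Fin n, i.1 ∈ τ ↔ M.U i u)
    {col : A → Fin H.length} (hcol : ∀ v, M.s u v → (M.subtree v).Models (H.get (col v)))
    (i : Fin H.length) :
    modelsC (StrData.node τ ((cs.map fun c => (col c).1).map (rep n (H.map MSO.code))))
      (H.get i).code = true ↔ (M.subtree u).Models (H.get i) := by
  have hf : List.Forall₂ (fun c (k : StrData) => k.Rooted ∧ (M.subtree c).EquivRank q (k.str n))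
      cs ((cs.map fun c => (col c).1).map (rep n (H.map MSO.code))) := by
    rw [List.map_map, List.forall₂_map_right_iff, List.forall₂_same]
    exact fun c hc' => hH.subtree_equivRank_rep hs (hcol c ((hc c).1 hc'))
  have he := M.subtree_equivRank_node hs hn hc hτ hf
  have hr : (StrData.node τ ((cs.map fun c => (col c).1).map (rep n (H.map MSO.code)))).Rooted := by
    refine StrData.rooted_node fun k hk => ?_
    simp only [List.map_map, List.mem_map, Function.comp] at hk
    obtain ⟨c, hc', rfl⟩ := hk
    exact (hH.subtree_equivRank_rep hs (hcol c ((hc c).1 hc'))).1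
  have : Nonempty {x // x ∈ (StrData.node τ ((cs.map fun c => (col c).1).map
    (rep n (H.map MSO.code)))).1} := ⟨0, hr.1⟩
  have hsen := hH.sentence _ (H.get_mem i)
  rw [hH.modelsC_iff hr, he.models_iff hsen.1 hsen.2]

end Saturation

/-! ### The `C²` sentences -/

namespace C2

variable {n : ℕ} {A : Type}

/-- The conjunction of a list of formulas. -/
def conj (L : List (C2 n)) : C2 n := L.foldr .and (.neg .bot)

/-- The disjunction of a list of formulas. -/
def disj (L : List (C2 n)) : C2 n := L.foldr .or .bot

theorem sat_conj {M : Str n A} {L : List (C2 n)} {e : Bool → A} :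
    (conj L).Sat M e ↔ ∀ φ ∈ L, φ.Sat M e := by
  induction L with
  | nil => simp [conj, Sat]
  | cons φ L ih =>
    rw [List.forall_mem_cons, ← ih]
    exact Iff.rfl

theorem sat_disj {M : Str n A} {L : List (C2 n)} {e : Bool → A} :
    (disj L).Sat M e ↔ ∃ φ ∈ L, φ.Sat M e := by
  induction L with
  | nil => simp [disj, Sat]
  | cons φ L ih =>
    rw [List.exists_mem_cons_iff, ← ih]
    exact Iff.rfl

theorem freeIn_conj {L : List (C2 n)} {E : Finset Bool} (h : ∀ φ ∈ L, φ.FreeIn E) :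
    (conj L).FreeIn E := by
  induction L with
  | nil => trivial
  | cons φ L ih =>
    rw [List.forall_mem_cons] at h
    exact ⟨h.1, ih h.2⟩

theorem freeIn_disj {L : List (C2 n)} {E : Finset Bool} (h : ∀ φ ∈ L, φ.FreeIn E) :
    (disj L).FreeIn E := by
  induction L with
  | nil => trivial
  | cons φ L ih =>
    rw [List.forall_mem_cons] at h
    exact ⟨h.1, ih h.2⟩

/-- A literal: the formula `φ` or its negation. -/
def literal (b : Bool) (φ : C2 n) : C2 n := if b then φ else .neg φ

theorem sat_literal {M : Str n A} {b : Bool} {φ : C2 n} {e : Bool → A} :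
    (literal b φ).Sat M e ↔ (b = true ↔ φ.Sat M e) := by
  cases b <;> simp [literal, Sat]

theorem freeIn_literal {b : Bool} {φ : C2 n} {E : Finset Bool} (h : φ.FreeIn E) :
    (literal b φ).FreeIn E := by
  cases b <;> exact h

/-- The labels of `x` in the original vocabulary are precisely those in `τ`. -/
def labels (n m : ℕ) (τ : List ℕ) : C2 (n + m) :=
  conj ((List.finRange n).map fun i => literal (decide (i.1 ∈ τ)) (.un (Fin.castAdd m i) false))

/-- The colour `i` occurs among the children of `x` as often as in `ℓ`. -/
def profile (n m : ℕ) (ℓ : List ℕ) : C2 (n + m) :=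
  conj ((List.finRange m).map fun i => .exEq (ℓ.count i.1) true
    (.and (.edge false true) (.un (Fin.natAdd n i) true)))

/-- The vertex `x` has precisely the colours whose sentences hold in the structure given by `d`. -/
def colours (n m : ℕ) (H : List ℕ) (d : StrData) : C2 (n + m) :=
  conj ((List.finRange m).map fun i =>
    literal (modelsC d (H.getD i.1 0)) (.un (Fin.natAdd n i) false))

/-- The sentence that determines the colour of a vertex from its labels and the colours of its
children. -/
def theta (n : ℕ) (H : List (MSO n)) : C2 (n + H.length) :=
  .all false (conj ((subs (List.range n)).flatMap fun τ =>
    (lists2 (List.range H.length)).map fun ℓ =>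
      .or (.neg (labels n H.length τ)) (.or (.neg (profile n H.length ℓ))
        (colours n H.length (H.map MSO.code)
          (StrData.node τ (ℓ.map (rep n (H.map MSO.code))))))))

/-- The root has a colour whose representative satisfies the sentence with code `c`. -/
def rootColour (n m : ℕ) (H : List ℕ) (c : ℕ) : C2 (n + m) :=
  .all false (.or (.neg (rt _)) (disj ((List.finRange m).map fun i =>
    if modelsC (rep n H i.1) c = true then .un (Fin.natAdd n i) false else .bot)))

/-- The translation of an MSO sentence. -/
def gamma (n : ℕ) (α : MSO n) : C2 (n + (MSO.hin n α.qr 0 0 0).length) :=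
  .and (theta n (MSO.hin n α.qr 0 0 0)) (rootColour n (MSO.hin n α.qr 0 0 0).length
    ((MSO.hin n α.qr 0 0 0).map MSO.code) α.code)

theorem isSentence_theta (n : ℕ) (H : List (MSO n)) : (theta n H).IsSentence := by
  refine freeIn_conj fun φ hφ => ?_
  simp only [List.mem_flatMap, List.mem_map] at hφ
  obtain ⟨τ, -, ℓ, -, rfl⟩ := hφ
  refine ⟨freeIn_conj ?_, freeIn_conj ?_, freeIn_conj ?_⟩
  · simp only [List.forall_mem_map]
    exact fun i _ => freeIn_literal (by simp [FreeIn])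
  · simp only [List.forall_mem_map]
    exact fun i _ => by simp [FreeIn]
  · simp only [List.forall_mem_map]
    exact fun i _ => freeIn_literal (by simp [FreeIn])

theorem isSentence_rootColour (n m : ℕ) (H : List ℕ) (c : ℕ) :
    (rootColour n m H c).IsSentence := by
  refine ⟨by simp [rt, FreeIn], freeIn_disj ?_⟩
  simp only [List.forall_mem_map]
  intro i _
  split_ifs <;> simp [FreeIn]

theorem isSentence_gamma (n : ℕ) (α : MSO n) : (gamma n α).IsSentence :=
  ⟨isSentence_theta n _, isSentence_rootColour n _ _ _⟩

theorem sat_labels {m : ℕ} {M : Str (n + m) A} {τ : List ℕ} {e : Bool → A} :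
    (labels n m τ).Sat M e ↔ ∀ i : Fin n, i.1 ∈ τ ↔ M.U (Fin.castAdd m i) (e false) := by
  simp [labels, sat_conj, sat_literal, Sat]

theorem sat_profile {m : ℕ} {M : Str (n + m) A} {ℓ : List ℕ} {e : Bool → A} :
    (profile n m ℓ).Sat M e ↔ ∀ i : Fin m,
      {a | M.s (e false) a ∧ M.U (Fin.natAdd n i) a}.encard = (ℓ.count i.1 : ℕ∞) := by
  simp [profile, sat_conj, Sat]

theorem sat_colours {m : ℕ} {M : Str (n + m) A} {H : List ℕ} {d : StrData} {e : Bool → A} :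
    (colours n m H d).Sat M e ↔ ∀ i : Fin m,
      modelsC d (H.getD i.1 0) = true ↔ M.U (Fin.natAdd n i) (e false) := by
  simp [colours, sat_conj, sat_literal, Sat]

theorem modelsC2_theta [Nonempty A] {H : List (MSO n)} {M : Str (n + H.length) A} :
    M.ModelsC2 (theta n H) ↔ ∀ u, ∀ τ ∈ subs (List.range n), ∀ ℓ ∈ lists2 (List.range H.length),
      (∀ i : Fin n, i.1 ∈ τ ↔ M.U (Fin.castAdd H.length i) u) →
      (∀ i : Fin H.length, {a | M.s u a ∧ M.U (Fin.natAdd n i) a}.encard = (ℓ.count i.1 : ℕ∞)) →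
      ∀ i : Fin H.length, modelsC (StrData.node τ (ℓ.map (rep n (H.map MSO.code))))
        (H.get i).code = true ↔ M.U (Fin.natAdd n i) u := by
  have hget (i : Fin H.length) : (H.map MSO.code).getD i.1 0 = (H.get i).code := by
    simp [List.getD_eq_getElem?_getD]
  obtain ⟨a⟩ := ‹Nonempty A›
  simp only [Str.ModelsC2, theta, Sat, sat_conj, List.mem_flatMap, List.mem_map,
    forall_exists_index, and_imp]
  constructor
  · intro h u τ hτ ℓ hℓ h1 h2
    have := h (fun _ => a) u _ τ hτ ℓ hℓ rfl
    simp only [Sat, sat_labels, sat_profile, sat_colours, Function.update_self, hget] at this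
    exact (this.resolve_left (not_not.2 h1)).resolve_left (not_not.2 h2)
  · rintro h e u _ τ hτ ℓ hℓ rfl
    simp only [Sat, sat_labels, sat_profile, sat_colours, Function.update_self, hget]
    have := h u τ hτ ℓ hℓ
    tauto

/-- Away from the root the negated `rt` makes the formula true. The predicate `p` records truth at
the root, independently of the value of the second variable. -/
theorem modelsC2_root_disj [Nonempty A] {M : Str n A} {r : A} (hr : ∀ x, (∀ y, ¬ M.s y x) ↔ x = r)
    (L : List (C2 n)) (p : C2 n → Prop) (hL : ∀ φ ∈ L, ∀ e : Bool → A, e false = r →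
      (φ.Sat M e ↔ p φ)) :
    M.ModelsC2 (.all false (.or (.neg (rt n)) (disj L))) ↔ ∃ φ ∈ L, p φ := by
  obtain ⟨a⟩ := ‹Nonempty A›
  simp only [Str.ModelsC2, Sat, sat_disj]
  constructor
  · intro h
    obtain h | ⟨φ, h1, h2⟩ := h (fun _ => a) r
    · refine absurd (fun y => ?_) h
      simpa [Sat] using (hr r).2 rfl y
    · exact ⟨φ, h1, (hL φ h1 _ (by simp)).1 h2⟩
  · rintro ⟨φ, h1, h2⟩ e x
    by_cases hx : x = r
    · exact Or.inr ⟨φ, h1, (hL φ h1 _ (by simp [hx])).2 h2⟩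
    · refine Or.inl fun h => hx ((hr x).1 fun y => ?_)
      simpa [rt, Sat] using h y

end C2

/-! ### The expansion by subtree types and the correctness of the `C²` sentences -/

section Colouring

variable {n q : ℕ} {H : List (MSO n)} {A : Type}

/-- The expansion of a structure by the types of the subtrees. -/
def Str.colouring (M : Str n A) (H : List (MSO n)) : Str (n + H.length) A where
  s := M.s
  U j u := Fin.addCases (motive := fun _ => Prop) (fun i => M.U i u)
    (fun i => (M.subtree u).Models (H.get i)) j

theorem Str.isExpansion_colouring (M : Str n A) (H : List (MSO n)) :
    M.IsExpansion (M.colouring H) := by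
  refine ⟨rfl, fun i => funext fun u => ?_⟩
  simp [Str.colouring]

theorem Str.IsExpansion.eq_colouring {M : Str n A} {N : Str (n + H.length) A} (h : M.IsExpansion N)
    (hU : ∀ (i : Fin H.length) (u : A),
      N.U (Fin.natAdd n i) u ↔ (M.subtree u).Models (H.get i)) : N = M.colouring H := by
  obtain ⟨s, U⟩ := N
  obtain ⟨rfl, h2⟩ := h
  unfold Str.colouring
  congr 1
  funext j u
  refine Fin.addCases (fun i => ?_) (fun i => ?_) j
  · simpa using congrFun (h2 i) u
  · simpa using hU i u

theorem List.Nodup.encard_setOf {α : Type} {l : List α} (hl : l.Nodup) (p : α → Bool) :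
    {a | a ∈ l ∧ p a = true}.encard = (l.countP p : ℕ∞) := by
  classical
  have : {a | a ∈ l ∧ p a = true} = ((l.filter p).toFinset : Set α) := by
    ext a
    simp
  rw [this, Set.encard_coe_eq_coe_finsetCard, List.toFinset_card_of_nodup (hl.filter p),
    List.countP_eq_length_filter]

/-- An expansion of a binary tree satisfies `theta` if and only if its colours are the types of the
subtrees. -/
theorem IsHintikkaSet.modelsC2_theta_iff (hH : IsHintikkaSet q H) [Finite A] {M : Str n A}
    (hs : IsBinaryTree M.s) {N : Str (n + H.length) A} (hN : M.IsExpansion N) :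
    N.ModelsC2 (C2.theta n H) ↔ ∀ (i : Fin H.length) (u : A),
      N.U (Fin.natAdd n i) u ↔ (M.subtree u).Models (H.get i) := by
  classical
  obtain ⟨hNs, hNU⟩ := hN
  have : Nonempty A := ⟨hs.2.1.choose⟩
  choose col hcol hcol' using fun u => hH.existsUnique_index (M.subtree u)
  have hcol_iff : ∀ u i, (M.subtree u).Models (H.get i) ↔ col u = i :=
    fun u i => ⟨fun h => (hcol' u i h).symm, fun h => h ▸ hcol u⟩
  have hcount : ∀ u (cs : List A), cs.Nodup → (∀ y, y ∈ cs ↔ M.s u y) →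
      (∀ v, M.s u v → ∀ i, N.U (Fin.natAdd n i) v ↔ (M.subtree v).Models (H.get i)) →
      ∀ i : Fin H.length, {a | N.s u a ∧ N.U (Fin.natAdd n i) a}.encard =
        ((cs.map fun c => (col c).1).count i.1 : ℕ∞) := by
    intro u cs hn hc hv i
    have h1 : {a | N.s u a ∧ N.U (Fin.natAdd n i) a} = {a | a ∈ cs ∧ decide (col a = i) = true} := by
      ext a
      simp only [Set.mem_ofPred_eq, decide_eq_true_eq, hc, hNs]
      refine and_congr_right fun ha => ?_
      rw [hv a ha, hcol_iff]
    rw [h1, hn.encard_setOf, List.count, List.countP_map]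
    congr 2
    funext a
    rw [Bool.eq_iff_iff]
    simp [Fin.ext_iff]
  rw [C2.modelsC2_theta]
  constructor
  · intro h i u
    induction u using hs.wellFounded.2.induction generalizing i with
    | _ u ih =>
      obtain ⟨cs, hn, hc, h2⟩ := hs.exists_children u
      have hτ : ∀ i : Fin n, i.1 ∈ (List.range n).filter (fun i =>
          decide (∃ h : i < n, M.U ⟨i, h⟩ u)) ↔ M.U i u := by
        intro i
        simp
      -- The instance of `theta` that applies at `u` is the one for the actual labels and the actual
      -- types of the children, of which there are at most two. By induction the colours of the
      -- children are correct, so the counts match.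
      rw [← h u _ (filter_mem_subs _ _) (cs.map fun c => (col c).1)
        (mem_lists2.2 ⟨by simpa using h2, by simp⟩) (fun i => by rw [hτ, hNU])
        (hcount u cs hn hc fun v hv i => ih v hv i) i]
      exact hH.modelsC_node_iff hs hn hc hτ (fun v _ => hcol v) i
  · intro h u τ hτ ℓ hℓ h1 h2 i
    obtain ⟨cs, hn, hc, -⟩ := hs.exists_children u
    -- `theta` speaks about every list with the right counts, and counts fix a list only up to
    -- order.
    have hperm : ℓ.Perm (cs.map fun c => (col c).1) := by
      rw [List.perm_iff_count]
      intro a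
      by_cases ha : a < H.length
      · have := (h2 ⟨a, ha⟩).symm.trans (hcount u cs hn hc (fun v _ i => h i v) ⟨a, ha⟩)
        exact_mod_cast this
      · rw [List.count_eq_zero_of_not_mem, List.count_eq_zero_of_not_mem]
        · simp only [List.mem_map, not_exists, not_and]
          rintro c - rfl
          exact ha (col c).2
        · exact fun h => ha (List.mem_range.1 ((mem_lists2.1 hℓ).2 a h))
    -- A rearrangement of the colours comes from a rearrangement of the children, and
    -- `modelsC_node_iff` accepts the children in any order.
    obtain ⟨cs', rfl, hp⟩ : ∃ cs' : List A, ℓ = cs'.map (fun c => (col c).1) ∧ cs'.Perm cs := by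
      have := congrFun₂ (List.eq_map_comp_perm (fun c => (col c).1)) ℓ cs
      exact cast this.symm hperm
    rw [h i u]
    exact hH.modelsC_node_iff hs (hp.nodup_iff.2 hn) (fun y => hp.mem_iff.trans (hc y))
      (fun i => by rw [h1, hNU]) (fun v _ => hcol v) i

theorem IsBinaryTree.exists_root {s : A → A → Prop} (h : IsBinaryTree s) :
    ∃ r, ∀ x, (∀ y, ¬ s y x) ↔ x = r := by
  obtain ⟨-, ⟨r, hr, hp⟩, -⟩ := h
  refine ⟨r, fun x => ⟨fun hx => ?_, ?_⟩⟩
  · by_contra hne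
    obtain ⟨y, hy, -⟩ := hp x hne
    exact hx y hy
  · rintro rfl
    exact hr

theorem isSentence_omegaHin (H : List (MSO n)) (ω : MSO n) : (omegaHin H ω).IsSentence := by
  refine ⟨by simp [C2.rt, C2.FreeIn], ?_⟩
  generalize List.filter _ _ = L
  induction L with
  | nil => trivial
  | cons i L ih => exact ⟨by simp [C2.FreeIn], ih⟩

theorem IsHintikkaSet.models_iff_omegaHin (hH : IsHintikkaSet q H) [Finite A] {M : Str n A}
    (hs : IsBinaryTree M.s) {N : Str (n + H.length) A} (hN : M.IsExpansion N)
    (hU : ∀ (i : Fin H.length) (u : A),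
      N.U (Fin.natAdd n i) u ↔ (M.subtree u).Models (H.get i))
    {ω : MSO n} (hω : ω.IsSentence) (hq : ω.qr ≤ q) :
    M.Models ω ↔ N.ModelsC2 (omegaHin H ω) := by
  classical
  obtain ⟨r, hr⟩ := hs.exists_root
  have : Nonempty A := ⟨r⟩
  have hroot := M.equivRank_subtree_root hs ((hr r).2 rfl)
  have heq : omegaHin H ω = .all false (.or (.neg (C2.rt _)) (C2.disj
      (((List.finRange H.length).filter fun i => (H.get i).Entails ω).map
        fun i => .un (hinSymbol H i) false))) := by
    simp only [omegaHin, C2.disj, List.foldr_map]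
  rw [heq, C2.modelsC2_root_disj (r := r) (by rw [hN.1]; exact hr) _
    (fun φ => ∃ i : Fin H.length, φ = .un (hinSymbol H i) false ∧ M.Models (H.get i))]
  · obtain ⟨S, hS, hSω⟩ := hH.disjunction ω hω hq
    constructor
    · intro h
      obtain ⟨ε, hε, h2⟩ := (hSω A M).1 h
      obtain ⟨i, rfl⟩ := List.mem_iff_get.1 (hS ε hε)
      refine ⟨_, List.mem_map.2 ⟨i, ?_, rfl⟩, i, rfl, h2⟩
      simp only [List.mem_filter, List.mem_finRange, true_and, decide_eq_true_eq]
      exact fun B _ _ K hK => (hSω B K).2 ⟨_, hε, hK⟩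
    · rintro ⟨φ, hφ, i, rfl, h⟩
      obtain ⟨j, hj, hji⟩ := List.mem_map.1 hφ
      obtain rfl : j = i := by simpa [hinSymbol] using hji
      simp only [List.mem_filter, List.mem_finRange, true_and, decide_eq_true_eq] at hj
      exact hj A M h
  · intro φ hφ e he
    obtain ⟨i, -, rfl⟩ := List.mem_map.1 hφ
    have h1 := (hroot q).models_iff (hH.sentence _ (H.get_mem i)).1 (hH.sentence _ (H.get_mem i)).2
    simp only [C2.Sat, he, hinSymbol, hU, ← h1, C2.un.injEq, and_true]
    constructor
    · exact fun h => ⟨i, rfl, h⟩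
    · rintro ⟨j, hj, h⟩
      obtain rfl : i = j := by simpa using hj
      exact h

/-- A computable substitute for `omegaHin`: the undecidable test whether a Hintikka sentence entails
`α` is replaced by checking `α` in its representative, which is enough on trees. -/
theorem IsHintikkaSet.models_iff_rootColour (hH : IsHintikkaSet q H) [Finite A] {M : Str n A}
    (hs : IsBinaryTree M.s) {N : Str (n + H.length) A} (hN : M.IsExpansion N)
    (hU : ∀ (i : Fin H.length) (u : A),
      N.U (Fin.natAdd n i) u ↔ (M.subtree u).Models (H.get i))
    {α : MSO n} (hα : α.IsSentence) (hq : α.qr ≤ q) :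
    M.Models α ↔ N.ModelsC2 (C2.rootColour n H.length (H.map MSO.code) α.code) := by
  obtain ⟨r, hr⟩ := hs.exists_root
  have : Nonempty A := ⟨r⟩
  have hroot := M.equivRank_subtree_root hs ((hr r).2 rfl) q
  -- For a sentence without a tree model `rep` is a meaningless default. Only the type of `M`
  -- matters, and `M` is a tree model of it.
  have hrep : ∀ i : Fin H.length, M.Models (H.get i) →
      (modelsC (rep n (H.map MSO.code) i) α.code = true ↔ M.Models α) := by
    intro i hi
    have hsen := hH.sentence _ (H.get_mem i)
    obtain ⟨h1, h2⟩ := hH.subtree_equivRank_rep hs ((hroot.models_iff hsen.1 hsen.2).1 hi)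
    have : Nonempty {x // x ∈ (rep n (H.map MSO.code) i).1} := ⟨0, h1.1⟩
    rw [modelsC_code_iff h1.1 hα, ← h2.models_iff hα hq, hroot.models_iff hα hq]
  rw [C2.rootColour, C2.modelsC2_root_disj (r := r) (by rw [hN.1]; exact hr) _
    (fun φ => ∃ i : Fin H.length, φ = .un (Fin.natAdd n i) false ∧ M.Models (H.get i))]
  · constructor
    · intro h
      obtain ⟨i, hi, -⟩ := hH.existsUnique_index M
      exact ⟨_, List.mem_map.2 ⟨i, List.mem_finRange i, if_pos ((hrep i hi).2 h)⟩, i, rfl, hi⟩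
    · rintro ⟨φ, hφ, i, rfl, h⟩
      obtain ⟨j, -, hji⟩ := List.mem_map.1 hφ
      split_ifs at hji with hm
      obtain rfl : j = i := by simpa using hji
      exact (hrep j h).1 hm
  · intro φ hφ e he
    obtain ⟨i, -, rfl⟩ := List.mem_map.1 hφ
    have h1 := hroot.models_iff (hH.sentence _ (H.get_mem i)).1 (hH.sentence _ (H.get_mem i)).2
    split_ifs
    · simp only [C2.Sat, he, hU, ← h1, C2.un.injEq, and_true]
      constructor
      · exact fun h => ⟨i, rfl, h⟩
      · rintro ⟨j, hj, h⟩
        obtain rfl : i = j := by simpa using hj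
        exact h
    · simp [C2.Sat]

end Colouring

/-! ### Primitive recursive functions on lists -/

-- With these closure properties registered, `fun_prop` proves primitive recursiveness by following
-- the syntax of a definition. The lemmas below are accordingly stated in composed form.
attribute [fun_prop] Primrec PrimrecPred Primrec.id Primrec.const Primrec.comp Primrec.pair
  PrimrecPred.not PrimrecPred.and PrimrecPred.or Primrec.ite

section PrimrecLemmas

variable {α β γ σ : Type} [Primcodable α] [Primcodable β] [Primcodable γ] [Primcodable σ]

@[fun_prop]
theorem Primrec.comp_fst {f : α → β × γ} (hf : Primrec f) : Primrec fun a => (f a).1 :=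
  Primrec.fst.comp hf

@[fun_prop]
theorem Primrec.comp_snd {f : α → β × γ} (hf : Primrec f) : Primrec fun a => (f a).2 :=
  Primrec.snd.comp hf

@[fun_prop]
theorem Primrec.natPair_comp {f g : α → ℕ} (hf : Primrec f) (hg : Primrec g) :
    Primrec fun a => Nat.pair (f a) (g a) := Primrec₂.natPair.comp hf hg

@[fun_prop]
theorem Primrec.natUnpair_comp {f : α → ℕ} (hf : Primrec f) :
    Primrec fun a => Nat.unpair (f a) := Primrec.unpair.comp hf

@[fun_prop]
theorem Primrec.add_comp {f g : α → ℕ} (hf : Primrec f) (hg : Primrec g) :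
    Primrec fun a => f a + g a := Primrec.nat_add.comp hf hg

@[fun_prop]
theorem Primrec.sub_comp {f g : α → ℕ} (hf : Primrec f) (hg : Primrec g) :
    Primrec fun a => f a - g a := Primrec.nat_sub.comp hf hg

@[fun_prop]
theorem Primrec.max_comp {f g : α → ℕ} (hf : Primrec f) (hg : Primrec g) :
    Primrec fun a => max (f a) (g a) := Primrec.nat_max.comp hf hg

@[fun_prop]
theorem Primrec.cons_comp {f : α → β} {g : α → List β} (hf : Primrec f) (hg : Primrec g) :
    Primrec fun a => f a :: g a := Primrec.list_cons.comp hf hg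

@[fun_prop]
theorem Primrec.append_comp {f g : α → List β} (hf : Primrec f) (hg : Primrec g) :
    Primrec fun a => f a ++ g a := Primrec.list_append.comp hf hg

@[fun_prop]
theorem Primrec.length_comp {f : α → List β} (hf : Primrec f) :
    Primrec fun a => (f a).length := Primrec.list_length.comp hf

@[fun_prop]
theorem Primrec.range_comp {f : α → ℕ} (hf : Primrec f) :
    Primrec fun a => List.range (f a) := Primrec.list_range.comp hf

@[fun_prop]
theorem Primrec.getD_comp {f : α → List β} {g : α → ℕ} (d : β) (hf : Primrec f) (hg : Primrec g) :
    Primrec fun a => (f a).getD (g a) d := (Primrec.list_getD d).comp hf hg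

@[fun_prop]
theorem Primrec.headI_comp [Inhabited β] {f : α → List β} (hf : Primrec f) :
    Primrec fun a => (f a).headI := Primrec.list_headI.comp hf

@[fun_prop]
theorem Primrec.map_comp {f : α → List β} {g : α → β → σ} (hf : Primrec f)
    (hg : Primrec fun p : α × β => g p.1 p.2) : Primrec fun a => (f a).map (g a) :=
  Primrec.list_map hf hg.to₂

@[fun_prop]
theorem Primrec.flatMap_comp {f : α → List β} {g : α → β → List σ} (hf : Primrec f)
    (hg : Primrec fun p : α × β => g p.1 p.2) : Primrec fun a => (f a).flatMap (g a) :=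
  Primrec.list_flatMap hf hg.to₂

@[fun_prop]
theorem Primrec.foldr_comp {f : α → List β} {g : α → σ} {h : α → β → σ → σ} (hf : Primrec f)
    (hg : Primrec g) (hh : Primrec fun p : α × β × σ => h p.1 p.2.1 p.2.2) :
    Primrec fun a => (f a).foldr (h a) (g a) :=
  Primrec.list_foldr (h := fun a p => h a p.1 p.2) hf hg hh.to₂

@[fun_prop]
theorem PrimrecPred.eq_comp {f g : α → β} (hf : Primrec f) (hg : Primrec g) :
    PrimrecPred fun a => f a = g a := Primrec.eq.comp hf hg

@[fun_prop]
theorem PrimrecPred.le_comp {f g : α → ℕ} (hf : Primrec f) (hg : Primrec g) :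
    PrimrecPred fun a => f a ≤ g a := Primrec.nat_le.comp hf hg

@[fun_prop]
theorem PrimrecPred.mem_comp {f : α → β} {g : α → List β} (hf : Primrec f) (hg : Primrec g) :
    PrimrecPred fun a => f a ∈ g a :=
  ((PrimrecRel.exists_mem_list (R := @Eq β) Primrec.eq).comp hg hf).of_eq fun a => by simp

@[fun_prop]
theorem Primrec.decide_comp {p : α → Prop} [DecidablePred p] (hp : PrimrecPred p) :
    Primrec fun a => decide (p a) := hp.decide

@[fun_prop]
theorem Primrec.filter_comp {f : α → List β} {p : α → β → Bool} (hf : Primrec f)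
    (hp : Primrec fun x : α × β => p x.1 x.2) : Primrec fun a => (f a).filter (p a) := by
  have : Primrec fun a => (f a).foldr (fun b s => if p a b = true then b :: s else s) [] :=
    Primrec.foldr_comp hf (by fun_prop) (Primrec.ite
      (PrimrecPred.eq_comp (hp.comp (g := fun q : α × β × List β => (q.1, q.2.1)) (by fun_prop))
        (Primrec.const true)) (by fun_prop) (by fun_prop))
  refine this.of_eq fun a => ?_
  induction f a with
  | nil => rfl
  | cons b l ih => simp [List.filter_cons, ih]

@[fun_prop]
theorem Primrec.valD_comp [Inhabited β] {f : α → List (ℕ × β)} {g : α → ℕ} (hf : Primrec f)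
    (hg : Primrec g) : Primrec fun a => valD (f a) (g a) :=
  Primrec.option_getD.comp (Primrec.listLookup.comp hg hf) (Primrec.const default)

@[fun_prop]
theorem Primrec.count_comp {f : α → List ℕ} {g : α → ℕ} (hf : Primrec f) (hg : Primrec g) :
    Primrec fun a => (f a).count (g a) := by
  have : Primrec fun a => ((f a).filter fun x => decide (x = g a)).length := by fun_prop
  refine this.of_eq fun a => ?_
  rw [List.count_eq_length_filter]
  congr 1

@[fun_prop]
theorem Primrec.subs_comp {f : α → List β} (hf : Primrec f) : Primrec fun a => subs (f a) := by
  unfold subs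
  fun_prop

@[fun_prop]
theorem Primrec.lists2_comp {f : α → List β} (hf : Primrec f) : Primrec fun a => lists2 (f a) := by
  unfold lists2
  fun_prop

end PrimrecLemmas

/-! ### Primitive recursiveness of model checking -/

section

variable {α : Type} [Primcodable α]

@[fun_prop]
theorem Primrec.childElt_comp {f g : α → ℕ} (hf : Primrec f) (hg : Primrec g) :
    Primrec fun a => childElt (f a) (g a) := by
  unfold childElt
  fun_prop

@[fun_prop]
theorem Primrec.node_comp {f : α → List ℕ} {g : α → List StrData} (hf : Primrec f)
    (hg : Primrec g) : Primrec fun a => StrData.node (f a) (g a) := by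
  unfold StrData.node
  fun_prop

theorem primrec_evalSub : Primrec fun p : StrData × ℕ × Env => evalSub p.1 p.2 := by
  unfold evalSub
  fun_prop

theorem primrec_evalStep :
    Primrec fun p : StrData × (ℕ × Env) × List Bool => evalStep p.1 p.2.1 p.2.2 := by
  -- The case distinction is pulled out of `decide` so that it becomes one between Boolean values.
  have h : ∀ (t : ℕ) (l : List Bool), decide (if t = 6 then true ∉ l else false ∉ l) =
      if t = 6 then decide (true ∉ l) else decide (false ∉ l) := by
    intro t l
    split_ifs <;> rfl
  unfold evalStep
  simp only [h]
  fun_prop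

/-- Recursion along a measure: the value at an argument is computed primitively recursively from the
values on the finite list `evalSub`, on which the code is smaller. -/
theorem primrec_evalC : Primrec₂ evalC :=
  Primrec.nat_omega_rec evalC (m := fun _ b => b.1) (l := evalSub)
    (g := fun d p => some (evalStep d p.1 p.2)) (Primrec.fst.comp Primrec.snd).to₂
    primrec_evalSub.to₂ (Primrec.option_some.comp primrec_evalStep).to₂ evalSub_lt
    fun d b => by rw [evalC_eq d b]

@[fun_prop]
theorem Primrec.modelsC_comp {f : α → StrData} {g : α → ℕ} (hf : Primrec f) (hg : Primrec g) :
    Primrec fun a => modelsC (f a) (g a) :=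
  primrec_evalC.comp hf (by fun_prop)

@[fun_prop]
theorem Primrec.treeData_comp {f g : α → ℕ} (hf : Primrec f) (hg : Primrec g) :
    Primrec fun a => treeData (f a) (g a) := by
  have hs : Primrec fun p : α × ℕ × List StrData =>
      p.2.2 ++ (subs (List.range (f p.1))).flatMap fun τ =>
        (lists2 p.2.2).map (StrData.node τ) := by fun_prop
  have h := Primrec.nat_rec' hg (Primrec.const ([] : List StrData)) hs.to₂
  refine h.of_eq fun a => ?_
  induction g a with
  | zero => rfl
  | succ k ih => simp only [treeData, ← ih]

@[fun_prop]
theorem Primrec.rep_comp {f h : α → ℕ} {g : α → List ℕ} (hf : Primrec f) (hg : Primrec g)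
    (hh : Primrec h) : Primrec fun a => rep (f a) (g a) (h a) := by
  unfold rep
  fun_prop

end

/-! ### Codes of the constructed sentences -/

namespace C2

/-- The code of a conjunction, from the list of codes. -/
def conjCode (L : List ℕ) : ℕ :=
  L.foldr (fun a b => Nat.pair 5 (Nat.pair a b)) (Nat.pair 4 (Nat.pair 0 0))

/-- The code of a disjunction, from the list of codes. -/
def disjCode (L : List ℕ) : ℕ :=
  L.foldr (fun a b => Nat.pair 6 (Nat.pair a b)) (Nat.pair 0 0)

/-- The code of a literal. -/
def literalCode (b : Bool) (c : ℕ) : ℕ := if b = true then c else Nat.pair 4 c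

/-- The code of `labels`. -/
def labelsCode (n : ℕ) (τ : List ℕ) : ℕ :=
  conjCode ((List.range n).map fun i =>
    literalCode (decide (i ∈ τ)) (Nat.pair 2 (Nat.pair i 0)))

/-- The code of `profile`. -/
def profileCode (n m : ℕ) (ℓ : List ℕ) : ℕ :=
  conjCode ((List.range m).map fun i => Nat.pair 11 (Nat.pair (ℓ.count i) (Nat.pair 1
    (Nat.pair 5 (Nat.pair (Nat.pair 3 (Nat.pair 0 1)) (Nat.pair 2 (Nat.pair (n + i) 1)))))))

/-- The code of `colours`. -/
def coloursCode (n m : ℕ) (H : List ℕ) (d : StrData) : ℕ :=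
  conjCode ((List.range m).map fun i =>
    literalCode (modelsC d (H.getD i 0)) (Nat.pair 2 (Nat.pair (n + i) 0)))

/-- The code of `theta`. -/
def thetaCode (n : ℕ) (H : List ℕ) : ℕ :=
  Nat.pair 8 (Nat.pair 0 (conjCode ((subs (List.range n)).flatMap fun τ =>
    (lists2 (List.range H.length)).map fun ℓ =>
      Nat.pair 6 (Nat.pair (Nat.pair 4 (labelsCode n τ))
        (Nat.pair 6 (Nat.pair (Nat.pair 4 (profileCode n H.length ℓ))
          (coloursCode n H.length H (StrData.node τ (ℓ.map (rep n H))))))))))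

/-- The code of `rootColour`. -/
def rootColourCode (n m : ℕ) (H : List ℕ) (c : ℕ) : ℕ :=
  Nat.pair 8 (Nat.pair 0 (Nat.pair 6 (Nat.pair
    (Nat.pair 4 (Nat.pair 8 (Nat.pair 1 (Nat.pair 4 (Nat.pair 3 (Nat.pair 1 0))))))
    (disjCode ((List.range m).map fun i => if modelsC (rep n H i) c = true then
      Nat.pair 2 (Nat.pair (n + i) 0) else Nat.pair 0 0)))))

variable {n : ℕ}

theorem code_conj (L : List (C2 n)) : (conj L).code = conjCode (L.map code) := by
  induction L with
  | nil => rfl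
  | cons φ L ih => exact congrArg (fun x => Nat.pair 5 (Nat.pair φ.code x)) ih

theorem code_disj (L : List (C2 n)) : (disj L).code = disjCode (L.map code) := by
  induction L with
  | nil => rfl
  | cons φ L ih => exact congrArg (fun x => Nat.pair 6 (Nat.pair φ.code x)) ih

theorem code_literal (b : Bool) (φ : C2 n) : (literal b φ).code = literalCode b φ.code := by
  cases b <;> rfl

/-- Passes from indices in `Fin m`, whose type depends on the vocabulary, to the plain numbers that
appear in codes. -/
theorem map_finRange {σ : Type} (m : ℕ) (f : Fin m → σ) (g : ℕ → σ) (h : ∀ i, f i = g i.1) :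
    (List.finRange m).map f = (List.range m).map g := by
  rw [← List.map_coe_finRange_eq_range, List.map_map]
  exact List.map_congr_left fun i _ => h i

theorem code_labels (n m : ℕ) (τ : List ℕ) : (labels n m τ).code = labelsCode n τ := by
  rw [labels, code_conj, List.map_map, labelsCode]
  exact congrArg _ (map_finRange _ _ _ fun i => by simp [code_literal, code])

theorem code_profile (n m : ℕ) (ℓ : List ℕ) : (profile n m ℓ).code = profileCode n m ℓ := by
  rw [profile, code_conj, List.map_map, profileCode]
  exact congrArg _ (map_finRange _ _ _ fun i => by simp [code])

theorem code_colours (n m : ℕ) (H : List ℕ) (d : StrData) :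
    (colours n m H d).code = coloursCode n m H d := by
  rw [colours, code_conj, List.map_map, coloursCode]
  exact congrArg _ (map_finRange _ _ _ fun i => by simp [code_literal, code])

theorem code_theta (n : ℕ) (H : List (MSO n)) :
    (theta n H).code = thetaCode n (H.map MSO.code) := by
  simp [theta, thetaCode, code, code_conj, List.map_flatMap, Function.comp_def, code_labels,
    code_profile, code_colours]

theorem code_rootColour (n m : ℕ) (H : List ℕ) (c : ℕ) :
    (rootColour n m H c).code = rootColourCode n m H c := by
  simp only [rootColour, rootColourCode, rt, code, code_disj, List.map_map, Bool.toNat_true,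
    Bool.toNat_false]
  rw [map_finRange m _ (fun i => if modelsC (rep n H i) c = true then
      Nat.pair 2 (Nat.pair (n + i) 0) else Nat.pair 0 0)]
  intro i
  simp only [Function.comp]
  split_ifs <;> simp [code]

section

variable {α : Type} [Primcodable α]

@[fun_prop]
theorem primrec_conjCode {f : α → List ℕ} (hf : Primrec f) : Primrec fun a => conjCode (f a) := by
  unfold conjCode
  fun_prop

@[fun_prop]
theorem primrec_disjCode {f : α → List ℕ} (hf : Primrec f) : Primrec fun a => disjCode (f a) := by
  unfold disjCode
  fun_prop

@[fun_prop]
theorem primrec_literalCode {f : α → Bool} {g : α → ℕ} (hf : Primrec f) (hg : Primrec g) :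
    Primrec fun a => literalCode (f a) (g a) := by
  unfold literalCode
  fun_prop

@[fun_prop]
theorem primrec_labelsCode {f : α → ℕ} {g : α → List ℕ} (hf : Primrec f) (hg : Primrec g) :
    Primrec fun a => labelsCode (f a) (g a) := by
  unfold labelsCode
  fun_prop

@[fun_prop]
theorem primrec_profileCode {f g : α → ℕ} {h : α → List ℕ} (hf : Primrec f) (hg : Primrec g)
    (hh : Primrec h) : Primrec fun a => profileCode (f a) (g a) (h a) := by
  unfold profileCode
  fun_prop

@[fun_prop]
theorem primrec_coloursCode {f g : α → ℕ} {h : α → List ℕ} {d : α → StrData} (hf : Primrec f)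
    (hg : Primrec g) (hh : Primrec h) (hd : Primrec d) :
    Primrec fun a => coloursCode (f a) (g a) (h a) (d a) := by
  unfold coloursCode
  fun_prop

@[fun_prop]
theorem primrec_thetaCode {f : α → ℕ} {g : α → List ℕ} (hf : Primrec f) (hg : Primrec g) :
    Primrec fun a => thetaCode (f a) (g a) := by
  unfold thetaCode
  fun_prop

@[fun_prop]
theorem primrec_rootColourCode {f g k : α → ℕ} {h : α → List ℕ} (hf : Primrec f)
    (hg : Primrec g) (hh : Primrec h) (hk : Primrec k) :
    Primrec fun a => rootColourCode (f a) (g a) (h a) (k a) := by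
  unfold rootColourCode
  fun_prop

end

end C2

/-! ### Codes of Hintikka formulas and quantifier ranks of codes -/

namespace MSO

/-- The codes of `signs`. -/
def signsCode (L : List ℕ) : List ℕ :=
  L.foldr (fun c l => l.map (fun x => Nat.pair 7 (Nat.pair c x)) ++
    l.map (fun x => Nat.pair 7 (Nat.pair (Nat.pair 6 c) x))) [Nat.pair 6 (Nat.pair 0 0)]

/-- The codes of `atoms`. -/
def atomsCode (n a b c : ℕ) : List ℕ :=
  (List.range a).flatMap fun x =>
    (List.range n).map (fun i => Nat.pair 2 (Nat.pair i x)) ++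
    ((List.range b).map (fun X => Nat.pair 4 (Nat.pair X x)) ++
    (List.range a).flatMap fun y =>
      Nat.pair 1 (Nat.pair x y) :: Nat.pair 3 (Nat.pair x y) ::
        (List.range c).map fun R => Nat.pair 5 (Nat.pair R (Nat.pair x y)))

@[fun_prop]
theorem primrec_signsCode {α : Type} [Primcodable α] {f : α → List ℕ} (hf : Primrec f) :
    Primrec fun a => signsCode (f a) := by
  unfold signsCode
  fun_prop

@[fun_prop]
theorem primrec_atomsCode {α : Type} [Primcodable α] {f g h k : α → ℕ} (hf : Primrec f)
    (hg : Primrec g) (hh : Primrec h) (hk : Primrec k) :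
    Primrec fun a => atomsCode (f a) (g a) (h a) (k a) := by
  unfold atomsCode
  fun_prop

theorem map_code_signs {n : ℕ} (L : List (MSO n)) :
    (signs L).map code = signsCode (L.map code) := by
  induction L with
  | nil => rfl
  | cons φ L ih =>
    simp only [signs, List.map_append, List.map_map, List.map_cons, signsCode, List.foldr_cons]
    rw [signsCode] at ih
    rw [← ih]
    simp [Function.comp_def, code]

theorem map_code_atoms (n a b c : ℕ) : (atoms n a b c).map code = atomsCode n a b c := by
  simp only [atoms, atomsCode, List.map_flatMap, List.map_append, List.map_map, List.map_cons]
  congr! 4 with x y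
  · exact C2.map_finRange _ _ _ fun i => rfl

/-- The parameters of the Hintikka formulas from which those with parameters `p` are built. -/
def hinSub (p : ℕ × ℕ × ℕ × ℕ) : List (ℕ × ℕ × ℕ × ℕ) :=
  if p.1 = 0 then [] else [(p.1 - 1, p.2.1 + 1, p.2.2.1, p.2.2.2),
    (p.1 - 1, p.2.1, p.2.2.1 + 1, p.2.2.2), (p.1 - 1, p.2.1, p.2.2.1, p.2.2.2 + 1)]

/-- The codes of the Hintikka formulas with parameters `p`, from those for `hinSub p`. -/
def hinStep (n : ℕ) (p : ℕ × ℕ × ℕ × ℕ) (l : List (List ℕ)) : List ℕ :=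
  signsCode (atomsCode n p.2.1 p.2.2.1 p.2.2.2 ++
    ((l.getD 0 []).map (fun c => Nat.pair 9 (Nat.pair p.2.1 c)) ++
      ((l.getD 1 []).map (fun c => Nat.pair 11 (Nat.pair p.2.2.1 c)) ++
        (l.getD 2 []).map (fun c => Nat.pair 13 (Nat.pair p.2.2.2 c)))))

theorem primrec_hinSub : Primrec fun p : ℕ × ℕ × ℕ × ℕ × ℕ => hinSub p.2 := by
  unfold hinSub
  fun_prop

theorem primrec_hinStep : Primrec fun p : ℕ × (ℕ × ℕ × ℕ × ℕ) × List (List ℕ) =>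
    hinStep p.1 p.2.1 p.2.2 := by
  unfold hinStep
  fun_prop

theorem hinSub_lt {p p' : ℕ × ℕ × ℕ × ℕ} (h : p' ∈ hinSub p) : p'.1 < p.1 := by
  unfold hinSub at h
  split_ifs at h with h0
  · simp at h
  · simp only [List.mem_cons, List.not_mem_nil, or_false] at h
    obtain rfl | rfl | rfl := h <;> dsimp only <;> omega

theorem hinStep_eq (n : ℕ) (p : ℕ × ℕ × ℕ × ℕ) :
    hinStep n p ((hinSub p).map fun p => (hin n p.1 p.2.1 p.2.2.1 p.2.2.2).map code) =
      (hin n p.1 p.2.1 p.2.2.1 p.2.2.2).map code := by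
  obtain ⟨q, a, b, c⟩ := p
  cases q with
  -- For rank `0` the list `hinSub` is empty, so the `getD` defaults remove the quantified part.
  | zero => simp [hin, hinStep, hinSub, map_code_signs, map_code_atoms]
  | succ q =>
    simp [hin, hinStep, hinSub, map_code_signs, map_code_atoms, Function.comp_def, code]

/-- The variable counts grow as the rank falls, so this is not a recursion with fixed parameters.
The rank serves as the measure. -/
theorem primrec_hin : Primrec₂ fun (n : ℕ) (p : ℕ × ℕ × ℕ × ℕ) =>
    (hin n p.1 p.2.1 p.2.2.1 p.2.2.2).map code :=
  Primrec.nat_omega_rec _ (m := fun _ p => p.1) (l := fun _ p => hinSub p)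
    (g := fun n x => some (hinStep n x.1 x.2)) (Primrec.fst.comp Primrec.snd).to₂
    primrec_hinSub.to₂ (Primrec.option_some.comp primrec_hinStep).to₂
    (fun _ _ _ h => hinSub_lt h) fun n p => congrArg some (hinStep_eq n p)

/-- The codes of the immediate subformulas. -/
def subCodes (c : ℕ) : List ℕ :=
  if c.unpair.1 = 6 then [c.unpair.2]
  else if c.unpair.1 = 7 ∨ c.unpair.1 = 8 then [c.unpair.2.unpair.1, c.unpair.2.unpair.2]
  else if 9 ≤ c.unpair.1 then [c.unpair.2.unpair.2]
  else []

theorem lt_of_mem_subCodes {c c' : ℕ} (h : c' ∈ subCodes c) : c' < c := by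
  have h0 : c.unpair.1 ≠ 0 → c.unpair.2 < c := snd_unpair_lt
  have h1 := Nat.unpair_left_le c.unpair.2
  have h2 := Nat.unpair_right_le c.unpair.2
  unfold subCodes at h
  split_ifs at h
  all_goals
    simp only [List.mem_cons, List.not_mem_nil, or_false] at h
    try obtain rfl | rfl := h
  all_goals
    try subst h
    have := h0 (by omega)
    omega

/-- The quantifier rank, on codes. -/
def qrCode (c : ℕ) : ℕ :=
  ((subCodes c).attach.map fun c' => qrCode c'.1).foldr max 0 + if 9 ≤ c.unpair.1 then 1 else 0
termination_by c
decreasing_by exact lt_of_mem_subCodes c'.2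

theorem qrCode_eq (c : ℕ) : qrCode c =
    ((subCodes c).map qrCode).foldr max 0 + if 9 ≤ c.unpair.1 then 1 else 0 := by
  rw [qrCode, List.attach_map_val (f := qrCode)]

theorem qrCode_code {n : ℕ} (φ : MSO n) : qrCode φ.code = φ.qr := by
  induction φ <;> rw [qrCode_eq] <;> simp_all [subCodes, code, qr]

@[fun_prop]
theorem primrec_qrCode : Primrec qrCode := by
  have h : Primrec fun p : ℕ × List ℕ =>
      p.2.foldr max 0 + if 9 ≤ p.1.unpair.1 then 1 else 0 := by fun_prop
  refine Primrec.nat_omega_rec' qrCode (m := id) (l := subCodes)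
    (g := fun c l => some (l.foldr max 0 + if 9 ≤ c.unpair.1 then 1 else 0)) Primrec.id ?_
    (Primrec.option_some.comp h).to₂ (fun c c' h => lt_of_mem_subCodes h)
    fun c => by rw [qrCode_eq c]
  unfold subCodes
  fun_prop

end MSO

/-! ### The main theorem -/

theorem mainTheorem6 :
    ∃ (Θ : (n q : ℕ) → (H : List (MSO n)) → C2 (n + H.length))
      (Hin : (n q : ℕ) → List (MSO n))
      (γ : (n : ℕ) → (α : MSO n) → C2 (n + (Hin n α.qr).length)),
      -- everything is computable, on Gödel numbers, uniformly in the vocabulary and the rank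
      (∃ f : ℕ × ℕ × List ℕ → ℕ, Computable f ∧
        ∀ (n q : ℕ) (H : List (MSO n)), f (n, q, H.map MSO.code) = (Θ n q H).code) ∧
      (∃ h : ℕ × ℕ → List ℕ, Computable h ∧
        ∀ n q : ℕ, h (n, q) = (Hin n q).map MSO.code) ∧
      (∃ g : ℕ × ℕ → ℕ, Computable g ∧
        ∀ (n : ℕ) (α : MSO n), g (n, α.code) = (γ n α).code) ∧
      (∀ n q : ℕ, IsHintikkaSet q (Hin n q)) ∧
      -- the sentence `Θ`, for every set of Hintikka sentences
      (∀ (n q : ℕ) (H : List (MSO n)), IsHintikkaSet q H →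
        (Θ n q H).IsSentence ∧
        (∀ ω : MSO n, (omegaHin H ω).IsSentence) ∧
        ∀ (A : Type) [Finite A] (T₀ : Str n A), IsBinaryTree T₀.s →
          (∃! T₁ : Str (n + H.length) A, T₀.IsExpansion T₁ ∧ T₁.ModelsC2 (Θ n q H)) ∧
          ∀ T₁ : Str (n + H.length) A, T₀.IsExpansion T₁ → T₁.ModelsC2 (Θ n q H) →
            (∀ (i : Fin H.length) (u : A),
              T₁.U (hinSymbol H i) u ↔ (T₀.subtree u).Models (H.get i)) ∧
            ∀ ω : MSO n, ω.IsSentence → ω.qr ≤ q →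
              (T₀.Models ω ↔ T₁.ModelsC2 (omegaHin H ω))) ∧
      -- the translation of an MSO sentence `α` to the `C²` sentence `γ`
      (∀ (n : ℕ) (α : MSO n), α.IsSentence →
        (γ n α).IsSentence ∧
        ∀ (A : Type) [Finite A] (M : Str n A), IsBinaryTree M.s →
          (M.Models α ↔
            ∃ N : Str (n + (Hin n α.qr).length) A, M.IsExpansion N ∧ N.ModelsC2 (γ n α)) ∧
          ∀ N : Str (n + (Hin n α.qr).length) A, M.IsExpansion N → N.ModelsC2 (γ n α) →
            N.ModelsC2 (Θ n α.qr (Hin n α.qr))) := by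
  refine ⟨fun n _ H => C2.theta n H, fun n q => MSO.hin n q 0 0 0, C2.gamma, ?_, ?_, ?_,
    MSO.isHintikkaSet_hin, ?_, ?_⟩
  · refine ⟨fun p => C2.thetaCode p.1 p.2.2, Primrec.to_comp (by fun_prop), fun n q H => ?_⟩
    exact (C2.code_theta n H).symm
  · exact ⟨fun p => (MSO.hin p.1 p.2 0 0 0).map MSO.code, Primrec.to_comp
      (MSO.primrec_hin.comp (g := fun p : ℕ × ℕ => p.1) (h := fun p => (p.2, 0, 0, 0))
        (by fun_prop) (by fun_prop)), fun _ _ => rfl⟩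
  -- The vocabulary of `γ` depends on the quantifier rank of `α`, which has to be recovered from the
  -- Gödel number of `α`.
  · have hH : Primrec fun p : ℕ × ℕ => (MSO.hin p.1 (MSO.qrCode p.2) 0 0 0).map MSO.code :=
      MSO.primrec_hin.comp (g := fun p : ℕ × ℕ => p.1)
        (h := fun p => (MSO.qrCode p.2, 0, 0, 0)) (by fun_prop) (by fun_prop)
    refine ⟨fun p => (fun H : List ℕ => Nat.pair 5 (Nat.pair (C2.thetaCode p.1 H)
      (C2.rootColourCode p.1 H.length H p.2))) ((MSO.hin p.1 (MSO.qrCode p.2) 0 0 0).map MSO.code),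
      Primrec.to_comp (by fun_prop), fun n α => ?_⟩
    simp only [MSO.qrCode_code, C2.gamma, C2.code, C2.code_theta, C2.code_rootColour,
      List.length_map]
  · intro n q H hH
    refine ⟨C2.isSentence_theta n H, isSentence_omegaHin H, fun A _ T₀ hs => ⟨?_, ?_⟩⟩
    · have hc := T₀.isExpansion_colouring H
      refine ⟨T₀.colouring H, ⟨hc, (hH.modelsC2_theta_iff hs hc).2 fun i u => ?_⟩,
        fun N hN => hN.1.eq_colouring ((hH.modelsC2_theta_iff hs hN.1).1 hN.2)⟩
      simp [Str.colouring]
    · intro T₁ hT hΘ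
      have hU := (hH.modelsC2_theta_iff hs hT).1 hΘ
      exact ⟨hU, fun ω hω hq => hH.models_iff_omegaHin hs hT hU hω hq⟩
  · intro n α hα
    refine ⟨C2.isSentence_gamma n α, fun A _ M hs => ?_⟩
    have hH := MSO.isHintikkaSet_hin n α.qr
    refine ⟨⟨fun h => ?_, ?_⟩, fun N _ hN e => (hN e).1⟩
    · have hc := M.isExpansion_colouring (MSO.hin n α.qr 0 0 0)
      have hU : ∀ (i : Fin (MSO.hin n α.qr 0 0 0).length) (u : A),
          (M.colouring (MSO.hin n α.qr 0 0 0)).U (Fin.natAdd n i) u ↔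
            (M.subtree u).Models ((MSO.hin n α.qr 0 0 0).get i) := fun i u => by
        simp [Str.colouring]
      exact ⟨_, hc, fun e => ⟨(hH.modelsC2_theta_iff hs hc).2 hU e,
        (hH.models_iff_rootColour hs hc hU hα le_rfl).1 h e⟩⟩
    · rintro ⟨N, hN, hγ⟩
      exact (hH.models_iff_rootColour hs hN
        ((hH.modelsC2_theta_iff hs hN).1 fun e => (hγ e).1) hα le_rfl).2 fun e => (hγ e).2
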